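/- Let $R$ be a ring with identity (associative, not necessarily commutative). "Complex" means unbounded chain complex of left $R$-modules unless right modules are specified; differentials lower degree. A complex $X$ is \emph{finitely generated} if whenever $X$ is the sum of a family of subcomplexes it is the sum of finitely many of them; it is \emph{finitely presented} if there is an exact sequence $P_1\to P_0\to X\to 0$ with $P_0,P_1$ finitely generated projective complexes; it is of \emph{type $FP_\infty$} if it has a projective resolution $\cdots\to P_1\to P_0\to X\to 0$ by finitely generated projective complexes. A short exact sequence $0\to X'\to X\to X''\to 0$ of complexes is \emph{pure exact} if it remains exact after applying $\mathrm{Hom}(F,-)$ for every finitely presented complex $F$; then $X'$ is called a pure subcomplex and $X''$ a pure quotient of $X$. For a complex $X$ of right $R$-modules and a complex $Y$ of left $R$-modules, the \emph{modified tensor product} $X\mathbin{\overline{\otimes}}Y$ is the complex of abelian groups with $(X\mathbin{\overline{\otimes}}Y)_n=(X\otimes Y)_n/B_n(X\otimes Y)$, where $X\otimes Y$ is the usual tensor product of complexes, with differential $\overline{x\otimes y}\mapsto\overline{dx\otimes y}$; $\overline{\mathrm{Tor}}_n$ denotes its $n$-th left derived functor. A complex $L$ is \emph{level} if $\overline{\mathrm{Tor}}_1(X,L)=0$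 for every complex $X$ of right $R$-modules of type $FP_\infty$. A complex $X$ is a \emph{transfinite extension} of objects of a class $\mathcal D$ if there are an ordinal $\lambda>0$ and a functor $i\mapsto X_i$ from $\lambda$ to complexes such that $X_0\in\mathcal D$, $X_\gamma=\operatorname{colim}_{i<\gamma}X_i$ for every limit ordinal $\gamma<\lambda$, each $X_i\to X_{i+1}$ (with $i+1<\lambda$) is a monomorphism with cokernel in $\mathcal D$, and $\operatorname{colim}_{i<\lambda}X_i\cong X$. Then the following hold. \begin{enumerate} \item If $L$ is a level complex, then $\overline{\mathrm{Tor}}_n(X,L)=0$ for all $n>0$ and all complexes $X$ of right $R$-modules of type $FP_\infty$. \item The class of level complexes is closed under pure subcomplexes and pure quotients. \item The class of level complexes is resolving: it contains all projective complexes, and for every short exact sequence $0\to L'\to L\to L''\to 0$ of complexes with $L''$ level, $L'$ is level if and only if $L$ is level (closure under extensions and under kernels of epimorphisms). \item The class of level complexes is closed under direct products, direct sums, retracts, direct limits (that is, small filtered colimits), and transfinite extensions. \end{enumerate} -/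

import Mathlib

open CategoryTheory CategoryTheory.Limits Opposite
open scoped TensorProduct

universe u

namespace LevelComplexes

noncomputable section

/-! ### Chain complexes -/

/-- The category of unbounded chain complexes of left `R`-modules, with differentials lowering
the degree. Right `R`-modules are left modules over `Rᵐᵒᵖ`, so complexes of right `R`-modules
are the objects of `Ch Rᵐᵒᵖ`. -/
abbrev Ch (R : Type u) [Ring R] : Type (u + 1) := ChainComplex (ModuleCat.{u} R) ℤ

/-- The category of unbounded chain complexes of abelian groups. -/
abbrev ChAb : Type (u + 1) := ChainComplex AddCommGrpCat.{u} ℤ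

theorem down_rel_sub_one (n : ℤ) : (ComplexShape.down ℤ).Rel n (n - 1) := sub_add_cancel n 1

theorem ne_sub_one (n : ℤ) : n ≠ n - 1 := by omega

/-- The disk on `M`, consisting of the identity of `M` in degrees `n` and `n - 1`. -/
def disk {R : Type u} [Ring R] (n : ℤ) (M : ModuleCat.{u} R) : Ch R :=
  HomologicalComplex.double (𝟙 M) (down_rel_sub_one n)

/-- Maps from the disk on `M` to `X` are maps from `M` to `X.X n`. -/
def diskCorep {R : Type u} [Ring R] (n : ℤ) (M : ModuleCat.{u} R) :
    (HomologicalComplex.eval (ModuleCat.{u} R) (ComplexShape.down ℤ) n ⋙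
      coyoneda.obj (op M)).CorepresentableBy (disk n M) :=
  HomologicalComplex.evalCompCoyonedaCorepresentableByDoubleId (down_rel_sub_one n)
    (ne_sub_one n) M

instance disk_projective {R : Type u} [Ring R] (n : ℤ) (M : ModuleCat.{u} R) [Projective M] :
    Projective (disk n M) where
  factors {E Y} f e he := by
    have hen : Epi (e.f n) :=
      inferInstanceAs
        (Epi ((HomologicalComplex.eval (ModuleCat.{u} R) (ComplexShape.down ℤ) n).map e))
    let g : M ⟶ Y.X n := (diskCorep n M).homEquiv f
    obtain ⟨g', hg⟩ : ∃ g' : M ⟶ E.X n, g' ≫ e.f n = g := Projective.factors (P := M) g (e.f n)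
    refine ⟨(diskCorep n M).homEquiv.symm g', ?_⟩
    apply (diskCorep n M).homEquiv.injective
    have h1 := (diskCorep n M).homEquiv_comp e ((diskCorep n M).homEquiv.symm g')
    have h2 : (diskCorep n M).homEquiv ((diskCorep n M).homEquiv.symm g') = g' :=
      Equiv.apply_symm_apply _ _
    refine h1.trans (Eq.trans ?_ hg)
    exact congrArg (fun φ : M ⟶ E.X n => φ ≫ e.f n) h2

/-- There are enough projective chain complexes: a complex `X` is a quotient of the direct sum
of the disks on projective modules mapping onto the `X.X n`. -/
instance enoughProjectives_ch (R : Type u) [Ring R] : EnoughProjectives (Ch R) where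
  presentation X := by
    let D : ℤ → Ch R := fun n => disk n (Projective.over (X.X n))
    let π : ∀ n, D n ⟶ X := fun n =>
      (diskCorep n (Projective.over (X.X n))).homEquiv.symm (Projective.π (X.X n))
    have hπ : ∀ n, Epi ((π n).f n) := fun n => by
      have h1 : (diskCorep n (Projective.over (X.X n))).homEquiv (π n) = Projective.π (X.X n) :=
        Equiv.apply_symm_apply _ _
      have h2 : (diskCorep n (Projective.over (X.X n))).homEquiv (π n) =
        (HomologicalComplex.doubleXIso₀ _ (down_rel_sub_one n)).inv ≫ (π n).f n := rfl
      exact epi_of_epi_fac (h2.symm.trans h1)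
    have : HasCoproduct D := inferInstance
    have hD : ∀ n, Projective (D n) := fun n => disk_projective _ _
    have hP : Projective (∐ D) := by
      constructor
      intro E Y f e he
      refine ⟨Sigma.desc fun n => Projective.factorThru (Sigma.ι D n ≫ f) e, ?_⟩
      apply Sigma.hom_ext
      intro n
      rw [Sigma.ι_desc_assoc, Projective.factorThru_comp]
    have he : Epi (Sigma.desc π) := by
      apply HomologicalComplex.epi_of_epi_f
      intro n
      have := hπ n
      have h : (Sigma.ι D n).f n ≫ (Sigma.desc π).f n = (π n).f n := by
        rw [← HomologicalComplex.comp_f, Sigma.ι_desc]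
      exact epi_of_epi_fac h
    exact ⟨{ p := ∐ D, projective := hP, f := Sigma.desc π, epi := he }⟩

/-! ### Finiteness conditions on chain complexes -/

/-- A subcomplex of a chain complex of modules. -/
structure Subcomplex {R : Type u} [Ring R] (X : Ch R) where
  carrier : ∀ n : ℤ, Submodule R (X.X n)
  d_mem : ∀ (m n : ℤ) (x : X.X m), x ∈ carrier m → (X.d m n).hom x ∈ carrier n

/-- The chain complex `X` is finitely generated: whenever `X` is the sum of a collection of
subcomplexes, it is already the sum of finitely many of them. -/
def FinitelyGenerated {R : Type u} [Ring R] (X : Ch R) : Prop :=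
  ∀ s : Set (Subcomplex X), (∀ n, ⨆ S ∈ s, S.carrier n = ⊤) →
    ∃ t ⊆ s, t.Finite ∧ ∀ n, ⨆ S ∈ t, S.carrier n = ⊤

/-- The chain complex `X` is finitely presented: there is an exact sequence `P₁ → P₀ → X → 0`
in which `P₀` and `P₁` are finitely generated projective complexes. -/
def FinitelyPresented {R : Type u} [Ring R] (X : Ch R) : Prop :=
  ∃ S : ShortComplex (Ch R), S.Exact ∧ Epi S.g ∧ Nonempty (S.X₃ ≅ X) ∧
    (Projective S.X₁ ∧ FinitelyGenerated S.X₁) ∧ (Projective S.X₂ ∧ FinitelyGenerated S.X₂)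

/-- The chain complex `X` is of type `FP_∞`: it has a projective resolution by finitely generated
projective complexes. -/
def IsFPInfinity {R : Type u} [Ring R] (X : Ch R) : Prop :=
  ∃ P : ProjectiveResolution X, ∀ i : ℕ, FinitelyGenerated (P.complex.X i)

/-- A short exact sequence of chain complexes is pure exact if it remains exact after applying
`Hom(F, -)` for every finitely presented complex `F`. -/
structure PureExact {R : Type u} [Ring R] (S : ShortComplex (Ch R)) : Prop where
  shortExact : S.ShortExact
  map_shortExact : ∀ F : Ch R, FinitelyPresented F →
    (S.map (preadditiveCoyoneda.obj (op F))).ShortExact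

/-! ### Tensor products over a noncommutative ring -/

section Tensor

variable {R : Type u} [Ring R]

/-- The subgroup of `M ⊗_ℤ N` generated by the elements `(m r) ⊗ n - m ⊗ (r n)`. -/
def balancing (M : ModuleCat.{u} Rᵐᵒᵖ) (N : ModuleCat.{u} R) : AddSubgroup (M ⊗[ℤ] N) :=
  AddSubgroup.closure
    {z | ∃ (m : M) (r : R) (n : N), z = (MulOpposite.op r • m) ⊗ₜ[ℤ] n - m ⊗ₜ[ℤ] (r • n)}

/-- The abelian group `M ⊗_R N`. -/
abbrev tensorObj (M : ModuleCat.{u} Rᵐᵒᵖ) (N : ModuleCat.{u} R) : AddCommGrpCat.{u} :=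
  AddCommGrpCat.of ((M ⊗[ℤ] N) ⧸ balancing M N)

/-- The class of `m ⊗ n` in `M ⊗_R N`. -/
def tmul {M : ModuleCat.{u} Rᵐᵒᵖ} {N : ModuleCat.{u} R} (m : M) (n : N) : tensorObj M N :=
  QuotientAddGroup.mk (m ⊗ₜ[ℤ] n)

theorem add_tmul {M : ModuleCat.{u} Rᵐᵒᵖ} {N : ModuleCat.{u} R} (m m' : M) (n : N) :
    tmul (m + m') n = tmul m n + tmul m' n :=
  congrArg QuotientAddGroup.mk (TensorProduct.add_tmul m m' n)

theorem tmul_add {M : ModuleCat.{u} Rᵐᵒᵖ} {N : ModuleCat.{u} R} (m : M) (n n' : N) :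
    tmul m (n + n') = tmul m n + tmul m n' :=
  congrArg QuotientAddGroup.mk (TensorProduct.tmul_add m n n')

/-- The map `M ⊗_ℤ N → M' ⊗_ℤ N'` induced by `f : M → M'` and `g : N → N'`. -/
def intTensorMap {M M' : ModuleCat.{u} Rᵐᵒᵖ} {N N' : ModuleCat.{u} R}
    (f : M ⟶ M') (g : N ⟶ N') : (M ⊗[ℤ] N) →+ (M' ⊗[ℤ] N') :=
  (TensorProduct.map f.hom.toAddMonoidHom.toIntLinearMap
    g.hom.toAddMonoidHom.toIntLinearMap).toAddMonoidHom

theorem intTensorMap_tmul {M M' : ModuleCat.{u} Rᵐᵒᵖ} {N N' : ModuleCat.{u} R}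
    (f : M ⟶ M') (g : N ⟶ N') (m : M) (n : N) :
    intTensorMap f g (m ⊗ₜ[ℤ] n) = f.hom m ⊗ₜ[ℤ] g.hom n := rfl

theorem balancing_le {M M' : ModuleCat.{u} Rᵐᵒᵖ} {N N' : ModuleCat.{u} R}
    (f : M ⟶ M') (g : N ⟶ N') :
    balancing M N ≤ (balancing M' N').comap (intTensorMap f g) := by
  refine (AddSubgroup.closure_le _).2 ?_
  rintro _ ⟨m, r, n, rfl⟩
  refine AddSubgroup.subset_closure ⟨f.hom m, r, g.hom n, ?_⟩
  rw [map_sub, intTensorMap_tmul, intTensorMap_tmul, map_smul, map_smul]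

/-- The map `M ⊗_R N → M' ⊗_R N'` induced by `f : M → M'` and `g : N → N'`. -/
def tensorMap {M M' : ModuleCat.{u} Rᵐᵒᵖ} {N N' : ModuleCat.{u} R}
    (f : M ⟶ M') (g : N ⟶ N') : tensorObj M N ⟶ tensorObj M' N' :=
  AddCommGrpCat.ofHom (QuotientAddGroup.map _ _ _ (balancing_le f g))

theorem tensorMap_tmul {M M' : ModuleCat.{u} Rᵐᵒᵖ} {N N' : ModuleCat.{u} R}
    (f : M ⟶ M') (g : N ⟶ N') (m : M) (n : N) :
    (tensorMap f g).hom (tmul m n) = tmul (f.hom m) (g.hom n) := rfl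

theorem tensor_hom_ext {M : ModuleCat.{u} Rᵐᵒᵖ} {N : ModuleCat.{u} R} {A : AddCommGrpCat.{u}}
    {f g : tensorObj M N ⟶ A} (h : ∀ (m : M) (n : N), f.hom (tmul m n) = g.hom (tmul m n)) :
    f = g := by
  apply AddCommGrpCat.hom_ext
  apply QuotientAddGroup.addMonoidHom_ext
  ext x
  induction x using TensorProduct.induction_on with
  | zero => rw [map_zero, map_zero]
  | tmul m n => exact h m n
  | add x y hx hy => rw [map_add, map_add, hx, hy]

variable (R) in
/-- The tensor product `M ⊗_R N` of a right and a left `R`-module, as a bifunctor to abelian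
groups: the quotient of `M ⊗_ℤ N` by the relations `(m r) ⊗ n = m ⊗ (r n)`. -/
def tensor : ModuleCat.{u} Rᵐᵒᵖ ⥤ ModuleCat.{u} R ⥤ AddCommGrpCat.{u} where
  obj M :=
    { obj := fun N => tensorObj M N
      map := fun g => tensorMap (𝟙 M) g
      map_id := fun _ => tensor_hom_ext fun _ _ => rfl
      map_comp := fun _ _ => tensor_hom_ext fun _ _ => rfl }
  map f :=
    { app := fun N => tensorMap f (𝟙 N)
      naturality := fun _ _ _ => tensor_hom_ext fun _ _ => rfl }
  map_id _ := NatTrans.ext (funext fun _ => tensor_hom_ext fun _ _ => rfl)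
  map_comp _ _ := NatTrans.ext (funext fun _ => tensor_hom_ext fun _ _ => rfl)

instance tensor_additive : (tensor R).Additive where
  map_add {_ _ f g} := NatTrans.ext (funext fun _ =>
    tensor_hom_ext fun m n => add_tmul (f.hom m) (g.hom m) n)

instance tensor_obj_additive (M : ModuleCat.{u} Rᵐᵒᵖ) : ((tensor R).obj M).Additive where
  map_add {_ _ f g} := tensor_hom_ext fun m n => tmul_add m (f.hom n) (g.hom n)

end Tensor

/-! ### The modified tensor product of chain complexes -/

/-- The usual signs `(-1)^p` for the tensor product of chain complexes: the total degree of
`x ⊗ y` is `|x| + |y|`, and `d (x ⊗ y) = dx ⊗ y + (-1)^|x| x ⊗ dy`. -/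
instance tensorSigns_down_int : ComplexShape.TensorSigns (ComplexShape.down ℤ) where
  ε' := MonoidHom.mk' Int.negOnePow Int.negOnePow_add
  rel_add p q r hpq := by
    have h : q + 1 = p := hpq
    change q + r + 1 = p + r
    omega
  add_rel p q r hpq := by
    have h : q + 1 = p := hpq
    change r + q + 1 = r + p
    omega
  ε'_succ p q hpq := by
    have h : q + 1 = p := hpq
    subst h
    change Int.negOnePow q = - Int.negOnePow (q + 1)
    rw [Int.negOnePow_succ, neg_neg]

/-- Bicomplexes of abelian groups. -/
abbrev BiCh : Type (u + 1) :=
  HomologicalComplex₂ AddCommGrpCat.{u} (ComplexShape.down ℤ) (ComplexShape.down ℤ)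

/-- The total complex `Tot K`, with `(Tot K)_n = ⨁_{p+q=n} K_{p,q}`. -/
abbrev tot (K : BiCh.{u}) : ChAb.{u} := K.total (ComplexShape.down ℤ)

theorem d_comp_D₁_comp_p (K : BiCh.{u}) (i j k : ℤ) :
    (tot K).d i j ≫ K.D₁ (ComplexShape.down ℤ) j k ≫ (tot K).pOpcycles k = 0 := by
  have h : (tot K).d i j ≫ K.D₁ (ComplexShape.down ℤ) j k =
      - K.D₁ (ComplexShape.down ℤ) i j ≫ (tot K).d j k := by
    rw [HomologicalComplex₂.total_d, HomologicalComplex₂.total_d]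
    simp
  rw [← Category.assoc, h]
  simp

/-- The complex which in degree `n` is `(Tot K)_n / B_n (Tot K)` (the cokernel of the
differential of `Tot K` with target `(Tot K)_n`), with differential induced by the first
differential of the bicomplex `K`. -/
def totModB (K : BiCh.{u}) : ChAb.{u} where
  X n := (tot K).opcycles n
  d i j := (tot K).descOpcycles (K.D₁ (ComplexShape.down ℤ) i j ≫ (tot K).pOpcycles j) _ rfl
    (d_comp_D₁_comp_p K _ _ _)
  shape i j h := by
    rw [← cancel_epi ((tot K).pOpcycles i), HomologicalComplex.p_descOpcycles,
      K.D₁_shape _ _ _ h]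
    simp
  d_comp_d' i j k _ _ := by
    rw [← cancel_epi ((tot K).pOpcycles i), HomologicalComplex.p_descOpcycles_assoc,
      Category.assoc, HomologicalComplex.p_descOpcycles, HomologicalComplex₂.D₁_D₁_assoc]
    simp

theorem totModB_comm {K L : BiCh.{u}} (φ : K ⟶ L) (i j : ℤ) :
    HomologicalComplex.opcyclesMap (HomologicalComplex₂.total.map φ (ComplexShape.down ℤ)) i ≫
      (tot L).descOpcycles (L.D₁ (ComplexShape.down ℤ) i j ≫ (tot L).pOpcycles j) _ rfl
        (d_comp_D₁_comp_p L _ _ _) =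
    (tot K).descOpcycles (K.D₁ (ComplexShape.down ℤ) i j ≫ (tot K).pOpcycles j) _ rfl
        (d_comp_D₁_comp_p K _ _ _) ≫
      HomologicalComplex.opcyclesMap
        (HomologicalComplex₂.total.map φ (ComplexShape.down ℤ)) j := by
  have h : (HomologicalComplex₂.total.map φ (ComplexShape.down ℤ)).f i ≫
      L.D₁ (ComplexShape.down ℤ) i j = K.D₁ (ComplexShape.down ℤ) i j ≫
        (HomologicalComplex₂.total.map φ (ComplexShape.down ℤ)).f j :=
    HomologicalComplex₂.total.mapAux.mapMap_D₁ φ _ i j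
  rw [← cancel_epi ((tot K).pOpcycles i)]
  simp only [HomologicalComplex.p_opcyclesMap_assoc,
    HomologicalComplex.p_descOpcycles, HomologicalComplex.p_descOpcycles_assoc,
    Category.assoc, HomologicalComplex.p_opcyclesMap]
  rw [← Category.assoc, h, Category.assoc]

/-- `totModB` as a functor. -/
def totModBFunctor : BiCh.{u} ⥤ ChAb.{u} where
  obj := totModB
  map φ :=
    { f := fun n => HomologicalComplex.opcyclesMap
        (HomologicalComplex₂.total.map φ (ComplexShape.down ℤ)) n
      comm' := fun i j _ => totModB_comm φ i j }
  map_id K := by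
    ext n : 1
    change HomologicalComplex.opcyclesMap _ n = 𝟙 ((tot K).opcycles n)
    rw [HomologicalComplex₂.total.map_id, HomologicalComplex.opcyclesMap_id]
  map_comp f g := by
    ext n : 1
    refine Eq.trans ?_ (HomologicalComplex.opcyclesMap_comp _ _ n)
    rw [← HomologicalComplex₂.total.map_comp]

theorem total_map_add {K L : BiCh.{u}} (f g : K ⟶ L) :
    HomologicalComplex₂.total.map (f + g) (ComplexShape.down ℤ) =
      HomologicalComplex₂.total.map f (ComplexShape.down ℤ) +
        HomologicalComplex₂.total.map g (ComplexShape.down ℤ) := by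
  ext n : 1
  apply HomologicalComplex₂.total.hom_ext
  intro i₁ i₂ h
  simp [Preadditive.comp_add]

theorem opcyclesMap_add {K L : ChAb.{u}} (f g : K ⟶ L) (n : ℤ) :
    HomologicalComplex.opcyclesMap (f + g) n =
      HomologicalComplex.opcyclesMap f n + HomologicalComplex.opcyclesMap g n := by
  rw [← cancel_epi (K.pOpcycles n)]
  simp [Preadditive.comp_add, Preadditive.add_comp]

instance totModBFunctor_additive : totModBFunctor.{u}.Additive where
  map_add {K L f g} := by
    ext n : 1
    exact (congrArg (fun φ => HomologicalComplex.opcyclesMap φ n) (total_map_add f g)).trans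
      (opcyclesMap_add _ _ n)

/-- The modified tensor product `X ⊗̄ Y` of a complex `X` of right `R`-modules and a complex `Y`
of left `R`-modules, as a bifunctor. In degree `n` it is `(X ⊗ Y)_n / B_n(X ⊗ Y)`, where `X ⊗ Y`
is the usual tensor product of complexes (the total complex of the bicomplex `X_p ⊗_R Y_q`), and
its differential sends the class of `x ⊗ y` to the class of `dx ⊗ y`. -/
def modTensor (R : Type u) [Ring R] : Ch Rᵐᵒᵖ ⥤ Ch R ⥤ ChAb.{u} :=
  (tensor R).mapBifunctorHomologicalComplex (ComplexShape.down ℤ) (ComplexShape.down ℤ) ⋙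
    (Functor.whiskeringRight _ _ _).obj totModBFunctor

instance modTensor_flip_additive (R : Type u) [Ring R] (Y : Ch R) :
    ((modTensor R).flip.obj Y).Additive where
  map_add {X X' f g} := by
    refine Eq.trans ?_ (totModBFunctor.map_add
      (f := (((tensor R).mapBifunctorHomologicalComplex _ _).map f).app Y)
      (g := (((tensor R).mapBifunctorHomologicalComplex _ _).map g).app Y))
    refine congrArg totModBFunctor.map ?_
    ext p q : 2
    exact congrArg (fun φ => φ.app (Y.X q)) ((tensor R).map_add (f := f.f p) (g := g.f p))

/-- The modified torsion complex `Tor̄_n(X, Y)`: the value at `X` of the `n`-th left derived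
functor of `- ⊗̄ Y`. -/
def modTor {R : Type u} [Ring R] (n : ℕ) (X : Ch Rᵐᵒᵖ) (Y : Ch R) : ChAb.{u} :=
  (((modTensor R).flip.obj Y).leftDerived n).obj X

/-! ### Level complexes -/

/-- The class of level complexes: those `L` with `Tor̄_1(X, L) = 0` for every complex `X` of right
`R`-modules of type `FP_∞`. -/
def level (R : Type u) [Ring R] : ObjectProperty (Ch R) := fun L =>
  ∀ X : Ch Rᵐᵒᵖ, IsFPInfinity X → IsZero (modTor 1 X L)

/-- The object `X` is a transfinite extension of objects in the class `D`: for some nonzero ordinal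
(here a well-ordered type `J` with least element `⊥`) there is a functor `F : J ⥤ C`, continuous
at limit elements, with `F ⊥` in `D`, such that every `F j ⟶ F (j + 1)` is a monomorphism with
cokernel in `D`, and with colimit isomorphic to `X`. -/
def IsTransfiniteExtension {R : Type u} [Ring R] (D : ObjectProperty (Ch R)) (X : Ch R) : Prop :=
  ∃ (J : Type u) (_ : LinearOrder J) (_ : WellFoundedLT J) (_ : OrderBot J) (_ : SuccOrder J)
    (F : J ⥤ Ch R) (c : Cocone F),
    F.IsWellOrderContinuous ∧ D (F.obj ⊥) ∧
    (∀ j : J, ¬ IsMax j → Mono (F.map (homOfLE (Order.le_succ j))) ∧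
      D (cokernel (F.map (homOfLE (Order.le_succ j))))) ∧
    Nonempty (IsColimit c) ∧ Nonempty (c.pt ≅ X)

end

end LevelComplexes

/-! The modified tensor product is adjoint to a dual-complex construction: maps from the degree `n`
part of `X ⊗̄ Y` to an abelian group `A` are chain maps from `X`, or from `Y`, into a shifted
complex of additive maps to `A`. If `P` is free on finitely many homogeneous generators of degrees
`k i`, this identifies `(P ⊗̄ Y)_n` with the product of the groups `Y_{n - k i}`, hence with `Hom(Q,
Y)` for `Q` free on generators of degrees `n - k i`. Splitting idempotents extends this to every
finitely generated projective `P` (`exists_degTensor_iso`).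

By Yoneda, a resolution `P` of a complex of type `FP_∞` therefore dualizes, in each degree `n`, to a
sequence `Q 0 ⟶ Q 1 ⟶ ⋯` of finitely generated projectives. Exactness of `P ⊗̄ L` becomes an
extension property: maps `Q (i + 1) ⟶ L` killed by `q i` factor through `q (i + 1)`
(`exists_dual_sequence`). Syzygies of complexes of type `FP_∞` are again of type `FP_∞`, so
vanishing of the first Tor gives this for all `i` (`level_iff`), which already yields the higher
vanishing.

The closure properties become short arguments about maps out of the `Q i`. Extensions and kernels
use their projectivity, purity uses that cokernels of the `q i` are finitely presented, and filtered
colimits use finite generation. Direct sums and transfinite extensions reduce to these. Projective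
complexes are treated separately: dualizing an exact sequence into an injective group keeps it
exact, and maps from a projective lift along it (`tensorExactAt_of_projective`). -/

namespace LevelComplexes

noncomputable section

/-! ### Generators, relations and universal property of `X ⊗̄ Y` in a fixed degree -/

section ModTensor

variable {R : Type u} [Ring R]

/-- The map from `K_{p,q}` to the degree `n` part of `Tot K` modulo boundaries. -/
def totModBι (K : BiCh.{u}) (p q n : ℤ) (h : p + q = n) : (K.X p).X q ⟶ (tot K).opcycles n :=
  K.ιTotal (ComplexShape.down ℤ) p q n h ≫ (tot K).pOpcycles n

theorem totModB_hom_ext {K : BiCh.{u}} {n : ℤ} {A : AddCommGrpCat.{u}}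
    {f g : (tot K).opcycles n ⟶ A}
    (H : ∀ p q h, totModBι K p q n h ≫ f = totModBι K p q n h ≫ g) : f = g := by
  have : Epi ((tot K).pOpcycles n) := inferInstance
  refine (cancel_epi ((tot K).pOpcycles n)).1 ?_
  apply HomologicalComplex₂.total.hom_ext
  intro p q h
  have := H p q h
  rw [totModBι, Category.assoc, Category.assoc] at this
  exact this

theorem totModBι_map {K L : BiCh.{u}} (φ : K ⟶ L) (p q n : ℤ) (h : p + q = n) :
    totModBι K p q n h ≫ HomologicalComplex.opcyclesMap
        (HomologicalComplex₂.total.map φ (ComplexShape.down ℤ)) n =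
      (φ.f p).f q ≫ totModBι L p q n h := by
  rw [totModBι, Category.assoc, HomologicalComplex.p_opcyclesMap,
    HomologicalComplex₂.ιTotal_map_assoc]
  rfl

theorem ιTotal_d (K : BiCh.{u}) (p q p' q' m n : ℤ) (hp : p' + 1 = p) (hq : q' + 1 = q)
    (hm : p + q = m) (h₁ : p' + q = n) (h₂ : p + q' = n) :
    K.ιTotal (ComplexShape.down ℤ) p q m hm ≫ (tot K).d m n =
      (K.d p p').f q ≫ K.ιTotal (ComplexShape.down ℤ) p' q n h₁ +
      p.negOnePow • ((K.X p).d q q' ≫ K.ιTotal (ComplexShape.down ℤ) p q' n h₂) := by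
  rw [HomologicalComplex₂.total_d, Preadditive.comp_add, HomologicalComplex₂.ι_D₁,
    HomologicalComplex₂.ι_D₂,
    HomologicalComplex₂.d₁_eq _ _ (show (ComplexShape.down ℤ).Rel p p' from hp) _ _ h₁,
    HomologicalComplex₂.d₂_eq _ _ _ (show (ComplexShape.down ℤ).Rel q q' from hq) _ h₂]
  congr 1
  exact one_smul _ _

theorem totModBι_rel (K : BiCh.{u}) (p q p' q' n : ℤ) (hp : p' + 1 = p) (hq : q' + 1 = q)
    (h₁ : p' + q = n) (h₂ : p + q' = n) :
    (K.d p p').f q ≫ totModBι K p' q n h₁ +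
      p.negOnePow • ((K.X p).d q q' ≫ totModBι K p q' n h₂) = 0 := by
  have := ιTotal_d K p q p' q' _ n hp hq rfl h₁ h₂
  have h := congrArg (· ≫ (tot K).pOpcycles n) this
  simp only [Category.assoc, HomologicalComplex.d_pOpcycles, comp_zero, Preadditive.add_comp,
    Linear.units_smul_comp] at h
  exact h.symm

/-- Homomorphisms out of the degree `n` part of `Tot K` modulo boundaries are compatible families
of homomorphisms out of the `K_{p,q}`. -/
theorem exists_totModB_desc {K : BiCh.{u}} {n : ℤ} {A : AddCommGrpCat.{u}}
    (b : ∀ p q, p + q = n → ((K.X p).X q ⟶ A))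
    (hb : ∀ p q p' q' (_ : p' + 1 = p) (_ : q' + 1 = q) (h₁ : p' + q = n) (h₂ : p + q' = n),
      (K.d p p').f q ≫ b p' q h₁ + p.negOnePow • ((K.X p).d q q' ≫ b p q' h₂) = 0) :
    ∃ f : (tot K).opcycles n ⟶ A, ∀ p q h, totModBι K p q n h ≫ f = b p q h := by
  let φ : (tot K).X n ⟶ A := HomologicalComplex₂.totalDesc _ b
  -- Compatibility of the family says exactly that `φ` kills the boundary of each summand with `p +
  -- q = n + 1`.
  have hφ : (tot K).d (n + 1) n ≫ φ = 0 := by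
    apply HomologicalComplex₂.total.hom_ext
    intro p q h
    have h' : p + q = n + 1 := h
    have h₁ : (p - 1) + q = n := by omega
    have h₂ : p + (q - 1) = n := by omega
    rw [← Category.assoc, ιTotal_d K p q (p - 1) (q - 1) (n + 1) n (by omega) (by omega) h h₁ h₂,
      comp_zero, Preadditive.add_comp, Linear.units_smul_comp, Category.assoc, Category.assoc,
      HomologicalComplex₂.ι_totalDesc, HomologicalComplex₂.ι_totalDesc]
    exact hb p q (p - 1) (q - 1) (by omega) (by omega) h₁ h₂
  refine ⟨(tot K).descOpcycles φ (n + 1) (by simp) hφ, fun p q h => ?_⟩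
  rw [totModBι, Category.assoc, HomologicalComplex.p_descOpcycles]
  exact HomologicalComplex₂.ι_totalDesc _ _ _ _ _

/-- The bicomplex `X_p ⊗_R Y_q`. -/
abbrev tensorBiCh (X : Ch Rᵐᵒᵖ) (Y : Ch R) : BiCh.{u} :=
  (((tensor R).mapBifunctorHomologicalComplex (ComplexShape.down ℤ) (ComplexShape.down ℤ)).obj
    X).obj Y

/-- The degree `n` part of the modified tensor product, as a bifunctor. -/
abbrev degTensor (R : Type u) [Ring R] (n : ℤ) : Ch Rᵐᵒᵖ ⥤ Ch R ⥤ AddCommGrpCat.{u} :=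
  modTensor R ⋙ (Functor.whiskeringRight _ _ _).obj (HomologicalComplex.eval _ _ n)

/-- The map from `X_p ⊗_R Y_q` to the degree `n` part of `X ⊗̄ Y`, where `p + q = n`. -/
def modι (X : Ch Rᵐᵒᵖ) (Y : Ch R) (p q n : ℤ) (h : p + q = n) :
    tensorObj (X.X p) (Y.X q) ⟶ ((degTensor R n).obj X).obj Y :=
  totModBι (tensorBiCh X Y) p q n h

theorem modTensor_hom_ext {X : Ch Rᵐᵒᵖ} {Y : Ch R} {n : ℤ} {A : AddCommGrpCat.{u}}
    {f g : ((degTensor R n).obj X).obj Y ⟶ A}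
    (H : ∀ p q h, modι X Y p q n h ≫ f = modι X Y p q n h ≫ g) : f = g :=
  totModB_hom_ext (K := tensorBiCh X Y) H

theorem modι_map_left {X X' : Ch Rᵐᵒᵖ} (f : X ⟶ X') (Y : Ch R) (p q n : ℤ) (h : p + q = n) :
    modι X Y p q n h ≫ ((degTensor R n).map f).app Y =
      tensorMap (f.f p) (𝟙 _) ≫ modι X' Y p q n h :=
  totModBι_map ((((tensor R).mapBifunctorHomologicalComplex (ComplexShape.down ℤ)
    (ComplexShape.down ℤ)).map f).app Y) p q n h

theorem modι_map_right (X : Ch Rᵐᵒᵖ) {Y Y' : Ch R} (g : Y ⟶ Y') (p q n : ℤ) (h : p + q = n) :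
    modι X Y p q n h ≫ ((degTensor R n).obj X).map g =
      tensorMap (𝟙 _) (g.f q) ≫ modι X Y' p q n h :=
  totModBι_map ((((tensor R).mapBifunctorHomologicalComplex (ComplexShape.down ℤ)
    (ComplexShape.down ℤ)).obj X).map g) p q n h

theorem modι_rel (X : Ch Rᵐᵒᵖ) (Y : Ch R) (p q p' q' n : ℤ) (hp : p' + 1 = p) (hq : q' + 1 = q)
    (h₁ : p' + q = n) (h₂ : p + q' = n) :
    tensorMap (X.d p p') (𝟙 _) ≫ modι X Y p' q n h₁ +
      p.negOnePow • (tensorMap (𝟙 _) (Y.d q q') ≫ modι X Y p q' n h₂) = 0 :=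
  totModBι_rel (tensorBiCh X Y) p q p' q' n hp hq h₁ h₂

/-- Homomorphisms out of the degree `n` part of `X ⊗̄ Y` are compatible families of homomorphisms
out of the `X_p ⊗_R Y_q`. -/
theorem exists_modTensor_desc {X : Ch Rᵐᵒᵖ} {Y : Ch R} {n : ℤ} {A : AddCommGrpCat.{u}}
    (b : ∀ p q, p + q = n → (tensorObj (X.X p) (Y.X q) ⟶ A))
    (hb : ∀ p q p' q' (_ : p' + 1 = p) (_ : q' + 1 = q) (h₁ : p' + q = n) (h₂ : p + q' = n),
      tensorMap (X.d p p') (𝟙 _) ≫ b p' q h₁ +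
        p.negOnePow • (tensorMap (𝟙 _) (Y.d q q') ≫ b p q' h₂) = 0) :
    ∃ f : ((degTensor R n).obj X).obj Y ⟶ A, ∀ p q h, modι X Y p q n h ≫ f = b p q h :=
  exists_totModB_desc (K := tensorBiCh X Y) b hb

/-- The class of `x ⊗ y` in `X ⊗̄ Y`. -/
def modTmul {X : Ch Rᵐᵒᵖ} {Y : Ch R} {n : ℤ} (p q : ℤ) (h : p + q = n) (x : X.X p) (y : Y.X q) :
    ((degTensor R n).obj X).obj Y :=
  (modι X Y p q n h).hom (tmul x y)

theorem modTmul_map_left {X X' : Ch Rᵐᵒᵖ} (f : X ⟶ X') (Y : Ch R) {n p q : ℤ} (h : p + q = n)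
    (x : X.X p) (y : Y.X q) :
    (((degTensor R n).map f).app Y).hom (modTmul p q h x y) = modTmul p q h ((f.f p).hom x) y :=
  congrArg (fun φ => φ.hom (tmul x y)) (modι_map_left f Y p q n h)

theorem modTmul_map_right (X : Ch Rᵐᵒᵖ) {Y Y' : Ch R} (g : Y ⟶ Y') {n p q : ℤ} (h : p + q = n)
    (x : X.X p) (y : Y.X q) :
    (((degTensor R n).obj X).map g).hom (modTmul p q h x y) = modTmul p q h x ((g.f q).hom y) :=
  congrArg (fun φ => φ.hom (tmul x y)) (modι_map_right X g p q n h)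

theorem modTmul_rel {X : Ch Rᵐᵒᵖ} {Y : Ch R} {n p q p' q' : ℤ} (hp : p' + 1 = p) (hq : q' + 1 = q)
    (h₁ : p' + q = n) (h₂ : p + q' = n) (x : X.X p) (y : Y.X q) :
    modTmul p' q h₁ ((X.d p p').hom x) y + p.negOnePow • modTmul p q' h₂ x ((Y.d q q').hom y) = 0 :=
  congrArg (fun φ => φ.hom (tmul x y)) (modι_rel X Y p q p' q' n hp hq h₁ h₂)

theorem modTmul_hom_ext {X : Ch Rᵐᵒᵖ} {Y : Ch R} {n : ℤ} {A : AddCommGrpCat.{u}}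
    {f g : ((degTensor R n).obj X).obj Y ⟶ A}
    (H : ∀ p q h (x : X.X p) (y : Y.X q), f.hom (modTmul p q h x y) = g.hom (modTmul p q h x y)) :
    f = g :=
  modTensor_hom_ext fun p q h => tensor_hom_ext fun x y => H p q h x y

theorem add_modTmul {X : Ch Rᵐᵒᵖ} {Y : Ch R} {n : ℤ} (p q : ℤ) (h : p + q = n) (x x' : X.X p)
    (y : Y.X q) : modTmul p q h (x + x') y = modTmul p q h x y + modTmul p q h x' y := by
  rw [modTmul, add_tmul, map_add]; rfl

theorem modTmul_add {X : Ch Rᵐᵒᵖ} {Y : Ch R} {n : ℤ} (p q : ℤ) (h : p + q = n) (x : X.X p)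
    (y y' : Y.X q) : modTmul p q h x (y + y') = modTmul p q h x y + modTmul p q h x y' := by
  rw [modTmul, tmul_add, map_add]; rfl

theorem smul_tmul {M : ModuleCat.{u} Rᵐᵒᵖ} {N : ModuleCat.{u} R} (r : R) (m : M) (n : N) :
    tmul (MulOpposite.op r • m) n = tmul m (r • n) :=
  (QuotientAddGroup.eq_iff_sub_mem).2 (AddSubgroup.subset_closure ⟨m, r, n, rfl⟩)

theorem smul_modTmul {X : Ch Rᵐᵒᵖ} {Y : Ch R} {n : ℤ} (p q : ℤ) (h : p + q = n) (r : R) (x : X.X p)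
    (y : Y.X q) : modTmul p q h (MulOpposite.op r • x) y = modTmul p q h x (r • y) :=
  congrArg _ (smul_tmul r x y)

/-- Balanced biadditive maps `M × N → A` induce homomorphisms `M ⊗_R N → A`. -/
def tensorLift {M : ModuleCat.{u} Rᵐᵒᵖ} {N : ModuleCat.{u} R} {A : AddCommGrpCat.{u}}
    (b : M →+ N →+ A) (hb : ∀ m (r : R) n, b (MulOpposite.op r • m) n = b m (r • n)) :
    tensorObj M N ⟶ A :=
  AddCommGrpCat.ofHom <| QuotientAddGroup.lift _
    (TensorProduct.liftAddHom b (fun z m n => by simp)) <| by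
      refine (AddSubgroup.closure_le _).2 ?_
      rintro _ ⟨m, r, n, rfl⟩
      change _ = _
      rw [map_sub, TensorProduct.liftAddHom_tmul, TensorProduct.liftAddHom_tmul, hb, sub_self]

theorem exists_modTmul_desc {X : Ch Rᵐᵒᵖ} {Y : Ch R} {n : ℤ} {A : AddCommGrpCat.{u}}
    (b : ∀ p q, p + q = n → (X.X p →+ Y.X q →+ A))
    (hb : ∀ p q h x (r : R) y, b p q h (MulOpposite.op r • x) y = b p q h x (r • y))
    (hd : ∀ p q p' q' (_ : p' + 1 = p) (_ : q' + 1 = q) (h₁ : p' + q = n) (h₂ : p + q' = n) x y,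
      b p' q h₁ ((X.d p p').hom x) y + p.negOnePow • b p q' h₂ x ((Y.d q q').hom y) = 0) :
    ∃ f : ((degTensor R n).obj X).obj Y ⟶ A, ∀ p q h x y,
      f.hom (modTmul p q h x y) = b p q h x y := by
  obtain ⟨f, hf⟩ := exists_modTensor_desc (fun p q h => tensorLift (b p q h) (hb p q h))
    (fun p q p' q' hp hq h₁ h₂ => tensor_hom_ext fun x y => hd p q p' q' hp hq h₁ h₂ x y)
  exact ⟨f, fun p q h x y => congrArg (fun φ => φ.hom (tmul x y)) (hf p q h)⟩

end ModTensor

/-! ### Dual complexes and the Hom–tensor adjunction -/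

section Dual

variable {R : Type u} [Ring R]

/-- Additive maps from a left module, as a type carrying a right module structure. -/
def DualRight (N : ModuleCat.{u} R) (A : AddCommGrpCat.{u}) : Type u := N →+ A

instance (N : ModuleCat.{u} R) (A : AddCommGrpCat.{u}) : AddCommGroup (DualRight N A) :=
  inferInstanceAs (AddCommGroup (N →+ A))

/-- The action is `(f r)(x) = f (r x)`; precomposition reverses the order of products, so it is a
right action. -/
instance (N : ModuleCat.{u} R) (A : AddCommGrpCat.{u}) : Module Rᵐᵒᵖ (DualRight N A) where
  smul r f := AddMonoidHom.comp f (DistribSMul.toAddMonoidHom N r.unop)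
  one_smul f := by
    let g : N →+ A := f
    exact DFunLike.ext (F := N →+ A) _ _ fun x => congrArg g (one_smul R x)
  mul_smul r s f := by
    let g : N →+ A := f
    exact DFunLike.ext (F := N →+ A) _ _ fun x => congrArg g (mul_smul s.unop r.unop x)
  smul_zero _ := rfl
  smul_add _ _ _ := rfl
  add_smul r s f := by
    let g : N →+ A := f
    exact DFunLike.ext (F := N →+ A) _ _ fun x =>
      (congrArg g (add_smul r.unop s.unop x)).trans (map_add g _ _)
  zero_smul f := by
    let g : N →+ A := f
    exact DFunLike.ext (F := N →+ A) _ _ fun x => (congrArg g (zero_smul R x)).trans (map_zero g)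

/-- Additive maps from a right module, as a type carrying a left module structure. -/
def DualLeft (M : ModuleCat.{u} Rᵐᵒᵖ) (A : AddCommGrpCat.{u}) : Type u := M →+ A

instance (M : ModuleCat.{u} Rᵐᵒᵖ) (A : AddCommGrpCat.{u}) : AddCommGroup (DualLeft M A) :=
  inferInstanceAs (AddCommGroup (M →+ A))

instance (M : ModuleCat.{u} Rᵐᵒᵖ) (A : AddCommGrpCat.{u}) : Module R (DualLeft M A) where
  smul r f := AddMonoidHom.comp f (DistribSMul.toAddMonoidHom M (MulOpposite.op r))
  one_smul f := by
    let g : M →+ A := f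
    exact DFunLike.ext (F := M →+ A) _ _ fun x => congrArg g (one_smul Rᵐᵒᵖ x)
  mul_smul r s f := by
    let g : M →+ A := f
    exact DFunLike.ext (F := M →+ A) _ _ fun x => congrArg g (mul_smul (MulOpposite.op s) (MulOpposite.op r) x)
  smul_zero _ := rfl
  smul_add _ _ _ := rfl
  add_smul r s f := by
    let g : M →+ A := f
    exact DFunLike.ext (F := M →+ A) _ _ fun x =>
      (congrArg g (add_smul (MulOpposite.op r) (MulOpposite.op s) x)).trans (map_add g _ _)
  zero_smul f := by
    let g : M →+ A := f
    exact DFunLike.ext (F := M →+ A) _ _ fun x => (congrArg g (zero_smul Rᵐᵒᵖ x)).trans (map_zero g)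

/-- The right module `Hom_ℤ(N, A)` of a left module `N`. -/
abbrev dualRight (N : ModuleCat.{u} R) (A : AddCommGrpCat.{u}) : ModuleCat.{u} Rᵐᵒᵖ :=
  ModuleCat.of Rᵐᵒᵖ (DualRight N A)

/-- The left module `Hom_ℤ(M, A)` of a right module `M`. -/
abbrev dualLeft (M : ModuleCat.{u} Rᵐᵒᵖ) (A : AddCommGrpCat.{u}) : ModuleCat.{u} R :=
  ModuleCat.of R (DualLeft M A)

/-- Elements of `dualRight N A` are additive maps. -/
def dualRight.toHom {N : ModuleCat.{u} R} {A : AddCommGrpCat.{u}} :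
    dualRight N A ≃+ (N →+ A) := AddEquiv.refl (N →+ A)

/-- Elements of `dualLeft M A` are additive maps. -/
def dualLeft.toHom {M : ModuleCat.{u} Rᵐᵒᵖ} {A : AddCommGrpCat.{u}} :
    dualLeft M A ≃+ (M →+ A) := AddEquiv.refl (M →+ A)

/-- Precomposition as a map of dual modules. -/
def dualRightMap {N N' : ModuleCat.{u} R} (g : N ⟶ N') (A : AddCommGrpCat.{u}) :
    dualRight N' A ⟶ dualRight N A :=
  ModuleCat.ofHom (
    { toFun := fun f => dualRight.toHom.symm ((dualRight.toHom f).comp g.hom.toAddMonoidHom)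
      map_add' := fun _ _ => rfl
      map_smul' := fun r f => DFunLike.ext (F := N →+ A) _ _ fun x =>
        congrArg (dualRight.toHom f) (g.hom.map_smul r.unop x).symm } :
      dualRight N' A →ₗ[Rᵐᵒᵖ] dualRight N A)

/-- Precomposition as a map of dual modules. -/
def dualLeftMap {M M' : ModuleCat.{u} Rᵐᵒᵖ} (g : M ⟶ M') (A : AddCommGrpCat.{u}) :
    dualLeft M' A ⟶ dualLeft M A :=
  ModuleCat.ofHom (
    { toFun := fun f => dualLeft.toHom.symm ((dualLeft.toHom f).comp g.hom.toAddMonoidHom)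
      map_add' := fun _ _ => rfl
      map_smul' := fun r f => DFunLike.ext (F := M →+ A) _ _ fun x =>
        congrArg (dualLeft.toHom f) (g.hom.map_smul (MulOpposite.op r) x).symm } :
      dualLeft M' A →ₗ[R] dualLeft M A)

theorem dualRightMap_zero {N N' : ModuleCat.{u} R} (A : AddCommGrpCat.{u}) :
    dualRightMap (0 : N ⟶ N') A = 0 := by
  ext f
  exact DFunLike.ext (F := N →+ A) _ _ fun x => map_zero (dualRight.toHom f)

theorem dualLeftMap_zero {M M' : ModuleCat.{u} Rᵐᵒᵖ} (A : AddCommGrpCat.{u}) :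
    dualLeftMap (0 : M ⟶ M') A = 0 := by
  ext f
  exact DFunLike.ext (F := M →+ A) _ _ fun x => map_zero (dualLeft.toHom f)

theorem dualRight_ext {N : ModuleCat.{u} R} {A : AddCommGrpCat.{u}} {f g : dualRight N A}
    (h : ∀ x, dualRight.toHom f x = dualRight.toHom g x) : f = g :=
  dualRight.toHom.injective (DFunLike.ext _ _ h)

theorem dualLeft_ext {M : ModuleCat.{u} Rᵐᵒᵖ} {A : AddCommGrpCat.{u}} {f g : dualLeft M A}
    (h : ∀ x, dualLeft.toHom f x = dualLeft.toHom g x) : f = g :=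
  dualLeft.toHom.injective (DFunLike.ext _ _ h)

/-- The complex of right modules `Hom_ℤ(Y, A)`, shifted so that a map from `X` to it is a map
from the degree `n` part of `X ⊗̄ Y` to `A`. -/
def dualComplexRight (Y : Ch R) (n : ℤ) (A : AddCommGrpCat.{u}) : Ch Rᵐᵒᵖ where
  X p := dualRight (Y.X (n - p)) A
  -- The sign is forced by the relation `dx ⊗ y = (-1)^p' x ⊗ dy` in `X ⊗̄ Y`, where `p = p' + 1`.
  d p p' := ((p'.negOnePow : ℤˣ) : ℤ) • dualRightMap (Y.d (n - p') (n - p)) A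
  shape p p' h := by
    rw [Y.shape]
    · rw [dualRightMap_zero, smul_zero]
    · intro h'
      have : (n - p) + 1 = n - p' := h'
      exact h (show p' + 1 = p by omega)
  d_comp_d' p p' p'' _ _ := by
    rw [Linear.smul_comp, Linear.comp_smul]
    convert smul_zero _
    convert smul_zero _
    ext f
    refine dualRight_ext fun x => ?_
    refine (congrArg (dualRight.toHom f) ?_).trans (map_zero (dualRight.toHom f))
    exact congrArg (fun φ => φ.hom x) (Y.d_comp_d (n - p'') (n - p') (n - p))

/-- The complex of left modules `Hom_ℤ(X, A)`, shifted so that a map from `Y` to it is a map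
from the degree `n` part of `X ⊗̄ Y` to `A`. -/
def dualComplexLeft (X : Ch Rᵐᵒᵖ) (n : ℤ) (A : AddCommGrpCat.{u}) : Ch R where
  X q := dualLeft (X.X (n - q)) A
  -- The same relation solved for `x ⊗ dy`: here `x` has degree `n - q'` and `dx` has degree `n -
  -- q`.
  d q q' := (((n - q).negOnePow : ℤˣ) : ℤ) • dualLeftMap (X.d (n - q') (n - q)) A
  shape q q' h := by
    rw [X.shape]
    · rw [dualLeftMap_zero, smul_zero]
    · intro h'
      have : (n - q) + 1 = n - q' := h'
      exact h (show q' + 1 = q by omega)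
  d_comp_d' q q' q'' _ _ := by
    rw [Linear.smul_comp, Linear.comp_smul]
    convert smul_zero _
    convert smul_zero _
    ext f
    refine dualLeft_ext fun x => ?_
    refine (congrArg (dualLeft.toHom f) ?_).trans (map_zero (dualLeft.toHom f))
    exact congrArg (fun φ => φ.hom x) (X.d_comp_d (n - q'') (n - q') (n - q))

/-- The map of left dual complexes induced by a map of complexes of right modules. -/
def dualComplexLeftMap {X X' : Ch Rᵐᵒᵖ} (f : X ⟶ X') (n : ℤ) (A : AddCommGrpCat.{u}) :
    dualComplexLeft X' n A ⟶ dualComplexLeft X n A where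
  f q := dualLeftMap (f.f (n - q)) A
  comm' q q' _ := by
    ext g
    refine dualLeft_ext fun x => ?_
    have : (f.f (n - q)).hom ((X.d (n - q') (n - q)).hom x) =
      (X'.d (n - q') (n - q)).hom ((f.f (n - q')).hom x) :=
      congrArg (fun φ => φ.hom x) (f.comm (n - q') (n - q)).symm
    change (n - q).negOnePow • dualLeft.toHom g ((f.f (n - q)).hom ((X.d (n - q') (n - q)).hom x)) =
      (n - q).negOnePow • dualLeft.toHom g ((X'.d (n - q') (n - q)).hom ((f.f (n - q')).hom x))
    rw [this]

variable {X : Ch Rᵐᵒᵖ} {Y : Ch R} {n : ℤ} {A : AddCommGrpCat.{u}}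

/-- Converts the boundary relation into the form in which the dual differentials are written, using
`(-1)^p = -(-1)^p'`. -/
theorem neg_eq_of_negOnePow {p p' : ℤ} (h : p' + 1 = p) {B : Type*} [AddCommGroup B] {a b : B}
    (hab : a + p.negOnePow • b = 0) : a = p'.negOnePow • b := by
  subst h
  rw [Int.negOnePow_succ, Units.neg_smul] at hab
  exact add_neg_eq_zero.1 hab

theorem negOnePow_smul_add {p p' : ℤ} (h : p' + 1 = p) {B : Type*} [AddCommGroup B] {a b : B}
    (hab : a = p'.negOnePow • b) : a + p.negOnePow • b = 0 := by
  subst h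
  rw [Int.negOnePow_succ, Units.neg_smul, hab, add_neg_cancel]

/-- The map to the dual complex corresponding to a map from the modified tensor product. -/
def toDualRight (f : ((degTensor R n).obj X).obj Y ⟶ A) : X ⟶ dualComplexRight Y n A where
  f p := ModuleCat.ofHom (
    { toFun := fun x => dualRight.toHom.symm (AddMonoidHom.mk'
        (fun y => f.hom (modTmul p (n - p) (add_sub_cancel p n) x y))
        fun y y' => by rw [modTmul_add, map_add])
      map_add' := fun x x' => dualRight_ext fun y =>
        (congrArg f.hom (add_modTmul _ _ _ x x' y)).trans (map_add _ _ _)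
      map_smul' := fun r x => dualRight_ext fun y =>
        congrArg f.hom (smul_modTmul _ _ _ r.unop x y) } :
      X.X p →ₗ[Rᵐᵒᵖ] dualRight (Y.X (n - p)) A)
  comm' p p' h := by
    ext x
    refine dualRight_ext fun y => ?_
    have h : p' + 1 = p := h
    have := modTmul_rel h (show n - p + 1 = n - p' by omega) (add_sub_cancel p' n)
      (add_sub_cancel p n) x y
    have := neg_eq_of_negOnePow h this
    exact ((congrArg f.hom this).trans (map_zsmul f.hom _ _)).symm

theorem toDualRight_apply (f : ((degTensor R n).obj X).obj Y ⟶ A) (p : ℤ) (x : X.X p)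
    (y : Y.X (n - p)) : dualRight.toHom (((toDualRight f).f p).hom x) y =
      f.hom (modTmul p (n - p) (add_sub_cancel p n) x y) := rfl

/-- The map to the dual complex corresponding to a map from the modified tensor product. -/
def toDualLeft (f : ((degTensor R n).obj X).obj Y ⟶ A) : Y ⟶ dualComplexLeft X n A where
  f q := ModuleCat.ofHom (
    { toFun := fun y => dualLeft.toHom.symm (AddMonoidHom.mk'
        (fun x => f.hom (modTmul (n - q) q (sub_add_cancel n q) x y))
        fun x x' => by rw [add_modTmul, map_add])
      map_add' := fun y y' => dualLeft_ext fun x =>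
        (congrArg f.hom (modTmul_add _ _ _ x y y')).trans (map_add _ _ _)
      map_smul' := fun r y => dualLeft_ext fun x =>
        congrArg f.hom (smul_modTmul _ _ _ r x y).symm } :
      Y.X q →ₗ[R] dualLeft (X.X (n - q)) A)
  comm' q q' h := by
    ext y
    refine dualLeft_ext fun x => ?_
    have h : q' + 1 = q := h
    have h' : n - q + 1 = n - q' := by omega
    have := modTmul_rel h' h (sub_add_cancel n q) (sub_add_cancel n q') x y
    have := neg_eq_of_negOnePow h' this
    change (n - q).negOnePow • f.hom (modTmul (n - q) q (sub_add_cancel n q)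
      ((X.d (n - q') (n - q)).hom x) y) = f.hom _
    rw [this]
    change (n - q).negOnePow • f.hom (((n - q).negOnePow : ℤ) • _) = _
    rw [map_zsmul]
    rw [← Units.smul_def, smul_smul, Int.units_mul_self, one_smul]
    rfl

theorem toDualLeft_apply (f : ((degTensor R n).obj X).obj Y ⟶ A) (q : ℤ) (x : X.X (n - q))
    (y : Y.X q) : dualLeft.toHom (((toDualLeft f).f q).hom y) x =
      f.hom (modTmul (n - q) q (sub_add_cancel n q) x y) := rfl

theorem modTmul_hom_ext_left {f g : ((degTensor R n).obj X).obj Y ⟶ A}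
    (H : ∀ q (x : X.X (n - q)) (y : Y.X q), f.hom (modTmul (n - q) q (sub_add_cancel n q) x y) =
      g.hom (modTmul (n - q) q (sub_add_cancel n q) x y)) : f = g := by
  apply modTmul_hom_ext
  intro p q h
  obtain rfl : p = n - q := by omega
  exact H q

theorem toDualLeft_injective :
    Function.Injective (toDualLeft (X := X) (Y := Y) (n := n) (A := A)) := by
  intro f g h
  apply modTmul_hom_ext_left
  intro q x y
  rw [← toDualLeft_apply, h, toDualLeft_apply]

theorem toDualRight_injective :
    Function.Injective (toDualRight (X := X) (Y := Y) (n := n) (A := A)) := by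
  intro f g h
  apply modTmul_hom_ext
  intro p q h' x y
  obtain rfl : q = n - p := by omega
  rw [← toDualRight_apply, h, toDualRight_apply]

/-- Linearity of the components of `ψ` is balancedness of the associated pairings, and commutation
of `ψ` with differentials is the boundary relation, so the pairings descend to `X ⊗̄ Y`. -/
theorem toDualRight_surjective :
    Function.Surjective (toDualRight (X := X) (Y := Y) (n := n) (A := A)) := by
  intro ψ
  let β : ∀ p, X.X p →+ Y.X (n - p) →+ A := fun p =>
    dualRight.toHom.toAddMonoidHom.comp (ψ.f p).hom.toAddMonoidHom
  -- The dual complex only sees the index `n - p`; the cast to a general `q` disappears once `q` is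
  -- substituted.
  let b : ∀ p q, p + q = n → (X.X p →+ Y.X q →+ A) := fun p q h =>
    (show n - p = q by omega) ▸ β p
  obtain ⟨f, hf⟩ := exists_modTmul_desc (X := X) (Y := Y) (n := n) (A := A) b
    (by
      intro p q h x r y
      obtain rfl : q = n - p := by omega
      exact congrArg (fun φ => dualRight.toHom φ y) ((ψ.f p).hom.map_smul (MulOpposite.op r) x))
    (by
      intro p q p' q' hp hq h₁ h₂ x y
      obtain rfl : q = n - p' := by omega
      obtain rfl : q' = n - p := by omega
      apply negOnePow_smul_add hp
      exact congrArg (fun φ => dualRight.toHom (φ.hom x) y) (ψ.comm p p').symm)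
  refine ⟨f, ?_⟩
  ext p x
  refine dualRight_ext fun y => ?_
  exact hf p (n - p) _ x y

theorem toDualLeft_surjective :
    Function.Surjective (toDualLeft (X := X) (Y := Y) (n := n) (A := A)) := by
  intro ψ
  let β : ∀ q, X.X (n - q) →+ Y.X q →+ A := fun q =>
    (dualLeft.toHom.toAddMonoidHom.comp (ψ.f q).hom.toAddMonoidHom).flip
  let b : ∀ p q, p + q = n → (X.X p →+ Y.X q →+ A) := fun p q h =>
    (show n - q = p by omega) ▸ β q
  obtain ⟨f, hf⟩ := exists_modTmul_desc (X := X) (Y := Y) (n := n) (A := A) b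
    (by
      intro p q h x r y
      obtain rfl : p = n - q := by omega
      exact congrArg (fun φ => dualLeft.toHom φ x) ((ψ.f q).hom.map_smul r y).symm)
    (by
      intro p q p' q' hp hq h₁ h₂ x y
      obtain rfl : p' = n - q := by omega
      obtain rfl : p = n - q' := by omega
      apply negOnePow_smul_add hp
      have : (n - q).negOnePow • β q ((X.d (n - q') (n - q)).hom x) y =
          β q' x ((Y.d q q').hom y) :=
        congrArg (fun φ => dualLeft.toHom (φ.hom y) x) (ψ.comm q q')
      change β q ((X.d (n - q') (n - q)).hom x) y =
        (n - q).negOnePow • β q' x ((Y.d q q').hom y)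
      rw [← this, smul_smul, Int.units_mul_self, one_smul])
  refine ⟨f, ?_⟩
  ext q y
  refine dualLeft_ext fun x => ?_
  exact hf (n - q) q _ x y

theorem toDualLeft_naturality {X' : Ch Rᵐᵒᵖ} (g : X' ⟶ X)
    (f : ((degTensor R n).obj X).obj Y ⟶ A) :
    toDualLeft (((degTensor R n).map g).app Y ≫ f) = toDualLeft f ≫ dualComplexLeftMap g n A := by
  ext q y
  refine dualLeft_ext fun x => ?_
  exact congrArg f.hom (modTmul_map_left g Y (sub_add_cancel n q) x y)

end Dual

/-! ### Homogeneous generators and free complexes -/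

section FiniteGeneration

variable {R : Type u} [Ring R]

/-- The family `x` of homogeneous elements generates the chain complex `X`. -/
def GeneratedBy (X : Ch R) {ι : Type u} (k : ι → ℤ) (x : ∀ i, X.X (k i)) : Prop :=
  ∀ S : Subcomplex X, (∀ i, x i ∈ S.carrier (k i)) → ∀ n, S.carrier n = ⊤

/-- The sum of a set of subcomplexes. -/
def Subcomplex.sSup {X : Ch R} (s : Set (Subcomplex X)) : Subcomplex X where
  carrier n := ⨆ S ∈ s, S.carrier n
  d_mem m n x hx := by
    have : (⨆ S ∈ s, S.carrier m) ≤ (⨆ S ∈ s, S.carrier n).comap (X.d m n).hom :=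
      iSup₂_le fun S hS y hy => Submodule.mem_iSup_of_mem S
        (Submodule.mem_iSup_of_mem hS (S.d_mem m n y hy))
    exact this hx

/-- The subcomplex generated by one homogeneous element. -/
def Subcomplex.span (X : Ch R) {k : ℤ} (x : X.X k) : Subcomplex X where
  carrier n := ⨅ S : {S : Subcomplex X // x ∈ S.carrier k}, S.1.carrier n
  d_mem m n y hy := by
    rw [Submodule.mem_iInf] at hy ⊢
    exact fun S => S.1.d_mem m n y (hy S)

theorem Subcomplex.mem_span {X : Ch R} {k : ℤ} (x : X.X k) : x ∈ (Subcomplex.span X x).carrier k :=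
  (Submodule.mem_iInf _).2 fun S => S.2

theorem Subcomplex.span_le {X : Ch R} {k : ℤ} {x : X.X k} {S : Subcomplex X}
    (h : x ∈ S.carrier k) (n : ℤ) : (Subcomplex.span X x).carrier n ≤ S.carrier n :=
  iInf_le (fun S : {S : Subcomplex X // x ∈ S.carrier k} => S.1.carrier n) ⟨S, h⟩

/-- A subcomplex as a chain complex. -/
def Subcomplex.toCh {X : Ch R} (S : Subcomplex X) : Ch R where
  X n := ModuleCat.of R (S.carrier n)
  d m n := ModuleCat.ofHom ((X.d m n).hom.restrict (S.d_mem m n))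
  shape m n h := by
    refine ModuleCat.hom_ext (LinearMap.ext fun x => Subtype.ext ?_)
    exact congrArg (fun φ => φ.hom x.1) (X.shape m n h)
  d_comp_d' i j k _ _ := by
    refine ModuleCat.hom_ext (LinearMap.ext fun x => Subtype.ext ?_)
    exact congrArg (fun φ => φ.hom x.1) (X.d_comp_d i j k)

/-- The inclusion of a subcomplex. -/
def Subcomplex.incl {X : Ch R} (S : Subcomplex X) : S.toCh ⟶ X where
  f n := ModuleCat.ofHom (S.carrier n).subtype
  comm' _ _ _ := rfl

/-- The image of a chain map. -/
def Subcomplex.range {X Y : Ch R} (f : X ⟶ Y) : Subcomplex Y where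
  carrier n := LinearMap.range (f.f n).hom
  d_mem m n := by
    rintro _ ⟨x, rfl⟩
    exact ⟨(X.d m n).hom x, congrArg (fun φ => φ.hom x) (f.comm m n).symm⟩

/-- The preimage of a subcomplex. -/
def Subcomplex.comap {X Y : Ch R} (f : X ⟶ Y) (S : Subcomplex Y) : Subcomplex X where
  carrier n := (S.carrier n).comap (f.f n).hom
  d_mem m n x hx := by
    have := S.d_mem m n _ hx
    rw [Submodule.mem_comap]
    convert this using 1
    exact congrArg (fun φ => φ.hom x) (f.comm m n).symm

/-- Each generator already lies in the sum of finitely many members of the family; collecting these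
over the finitely many generators suffices. -/
theorem FinitelyGenerated.of_generatedBy {X : Ch R} {ι : Type u} [Finite ι] {k : ι → ℤ}
    {x : ∀ i, X.X (k i)} (h : GeneratedBy X k x) : FinitelyGenerated X := by
  intro s hs
  have key : ∀ i, ∃ t ⊆ s, t.Finite ∧ x i ∈ (Subcomplex.sSup t).carrier (k i) := by
    intro i
    have hx : x i ∈ ⨆ S : s, S.1.carrier (k i) := by
      rw [iSup_subtype, hs]
      trivial
    obtain ⟨t, ht⟩ := Submodule.exists_finset_of_mem_iSup _ hx
    refine ⟨Subtype.val '' (t : Set s), by rintro _ ⟨S, _, rfl⟩; exact S.2,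
      t.finite_toSet.image _, ?_⟩
    have hle : (⨆ S ∈ t, S.1.carrier (k i)) ≤
        (Subcomplex.sSup (Subtype.val '' (t : Set s))).carrier (k i) :=
      iSup₂_le fun S hS => le_iSup₂_of_le S.1 ⟨S, hS, rfl⟩ le_rfl
    exact hle ht
  choose t ht htf hxt using key
  refine ⟨⋃ i, t i, Set.iUnion_subset ht, Set.finite_iUnion htf, ?_⟩
  refine h (Subcomplex.sSup (⋃ i, t i)) fun i => ?_
  have hle : (Subcomplex.sSup (t i)).carrier (k i) ≤
      (Subcomplex.sSup (⋃ i, t i)).carrier (k i) :=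
    iSup₂_le fun S hS => le_iSup₂_of_le S (Set.mem_iUnion_of_mem i hS) le_rfl
  exact hle (hxt i)

/-- Every complex is the sum of its subcomplexes generated by one homogeneous element. A finite
subfamily suffices, and that subfamily serves as the index type. -/
theorem FinitelyGenerated.exists_generatedBy {X : Ch R} (h : FinitelyGenerated X) :
    ∃ (ι : Type u) (_ : Finite ι) (k : ι → ℤ) (x : ∀ i, X.X (k i)), GeneratedBy X k x := by
  obtain ⟨t, hts, htf, ht⟩ := h (Set.range fun x : Σ k, X.X k => Subcomplex.span X x.2) (by
    intro n
    refine eq_top_iff.2 fun x _ => ?_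
    exact Submodule.mem_iSup_of_mem _
      (Submodule.mem_iSup_of_mem ⟨⟨n, x⟩, rfl⟩ (Subcomplex.mem_span x)))
  choose g hg using fun S : t => hts S.2
  refine ⟨t, htf, fun S => (g S).1, fun S => (g S).2, fun S hS n => ?_⟩
  rw [eq_top_iff, ← ht n]
  refine iSup₂_le fun T hT => ?_
  have := Subcomplex.span_le (hS ⟨T, hT⟩) n
  have e : Subcomplex.span X (g ⟨T, hT⟩).2 = T := hg ⟨T, hT⟩
  rwa [e] at this

theorem epi_f_surjective {X Y : Ch R} (f : X ⟶ Y) [Epi f] (n : ℤ) :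
    Function.Surjective (f.f n).hom := by
  have : Epi (f.f n) :=
    inferInstanceAs (Epi ((HomologicalComplex.eval (ModuleCat.{u} R) (ComplexShape.down ℤ) n).map f))
  exact (ModuleCat.epi_iff_surjective (f.f n)).1 this

theorem epi_of_surjective {X Y : Ch R} (f : X ⟶ Y) (h : ∀ n, Function.Surjective (f.f n).hom) :
    Epi f :=
  HomologicalComplex.epi_of_epi_f f fun n => (ModuleCat.epi_iff_surjective (f.f n)).2 (h n)

theorem GeneratedBy.map {X Y : Ch R} {ι : Type u} {k : ι → ℤ} {x : ∀ i, X.X (k i)}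
    (h : GeneratedBy X k x) (f : X ⟶ Y) [Epi f] :
    GeneratedBy Y k (fun i => (f.f (k i)).hom (x i)) := by
  intro S hS n
  refine eq_top_iff.2 fun y _ => ?_
  obtain ⟨x, rfl⟩ := epi_f_surjective f n y
  have := h (S.comap f) hS n
  have hx : x ∈ (S.comap f).carrier n := this ▸ Submodule.mem_top
  exact hx

theorem FinitelyGenerated.of_epi {X Y : Ch R} (h : FinitelyGenerated X) (f : X ⟶ Y) [Epi f] :
    FinitelyGenerated Y := by
  obtain ⟨ι, _, k, x, hx⟩ := h.exists_generatedBy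
  exact .of_generatedBy (hx.map f)

/-- The equalizer of two chain maps is a subcomplex. -/
theorem GeneratedBy.hom_ext {X Y : Ch R} {ι : Type u} {k : ι → ℤ} {x : ∀ i, X.X (k i)}
    (h : GeneratedBy X k x) {f g : X ⟶ Y}
    (hfg : ∀ i, (f.f (k i)).hom (x i) = (g.f (k i)).hom (x i)) : f = g := by
  let S : Subcomplex X :=
    { carrier := fun n => LinearMap.eqLocus (f.f n).hom (g.f n).hom
      d_mem := fun m n x hx => by
        have h₁ : (f.f n).hom ((X.d m n).hom x) = (Y.d m n).hom ((f.f m).hom x) :=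
          congrArg (fun φ => φ.hom x) (f.comm m n).symm
        have h₂ : (g.f n).hom ((X.d m n).hom x) = (Y.d m n).hom ((g.f m).hom x) :=
          congrArg (fun φ => φ.hom x) (g.comm m n).symm
        rw [LinearMap.mem_eqLocus] at hx ⊢
        rw [h₁, h₂, hx] }
  ext n x
  have := h S hfg n
  exact (this ▸ Submodule.mem_top : x ∈ S.carrier n)

/-- The chain complex `P` is free on the family `e` of homogeneous elements. -/
def IsFreeOn (P : Ch R) {ι : Type u} (k : ι → ℤ) (e : ∀ i, P.X (k i)) : Prop :=
  ∀ (Y : Ch R) (y : ∀ i, Y.X (k i)), ∃! f : P ⟶ Y, ∀ i, (f.f (k i)).hom (e i) = y i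

theorem exists_isFreeOn_disk (k : ℤ) (Y : Ch R) (y : Y.X k) :
    ∃! f : disk k (ModuleCat.of R R) ⟶ Y, (f.f k).hom
      ((HomologicalComplex.doubleXIso₀ (𝟙 (ModuleCat.of R R)) (down_rel_sub_one k)).inv.hom
        (1 : R)) = y := by
  refine ⟨(diskCorep k (ModuleCat.of R R)).homEquiv.symm
    (ModuleCat.ofHom (LinearMap.toSpanSingleton R _ y)), ?_, ?_⟩
  · have := (diskCorep k (ModuleCat.of R R)).homEquiv.apply_symm_apply
      (ModuleCat.ofHom (LinearMap.toSpanSingleton R _ y))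
    refine (congrArg (fun φ => φ.hom (1 : R)) this).trans ?_
    exact one_smul R y
  · intro g hg
    refine ((diskCorep k (ModuleCat.of R R)).homEquiv.eq_symm_apply).2 ?_
    refine ModuleCat.hom_ext (LinearMap.ext_ring ?_)
    exact hg.trans (one_smul R y).symm

/-- The coproduct of the disks on `R` with top degrees `k i` works, the generators being the
elements `1` in those degrees. -/
theorem exists_isFreeOn (R : Type u) [Ring R] {ι : Type u} (k : ι → ℤ) :
    ∃ (P : Ch R) (e : ∀ i, P.X (k i)), IsFreeOn P k e := by
  let D : ι → Ch R := fun i => disk (k i) (ModuleCat.of R R)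
  let d : ∀ i, (D i).X (k i) := fun i =>
    (HomologicalComplex.doubleXIso₀ (𝟙 (ModuleCat.of R R)) (down_rel_sub_one (k i))).inv.hom (1 : R)
  refine ⟨∐ D, fun i => ((Sigma.ι D i).f (k i)).hom (d i), fun Y y => ?_⟩
  choose f hf hf' using fun i => exists_isFreeOn_disk (k i) Y (y i)
  refine ⟨Sigma.desc f, fun i => ?_, fun g hg => ?_⟩
  · have : (Sigma.ι D i ≫ Sigma.desc f) = f i := Sigma.ι_desc f i
    exact (congrArg (fun φ => (φ.f (k i)).hom (d i)) this).trans (hf i)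
  · apply Sigma.hom_ext
    intro i
    rw [Sigma.ι_desc]
    exact hf' i _ (hg i)

section Free

variable {P : Ch R} {ι : Type u} {k : ι → ℤ} {e : ∀ i, P.X (k i)}

/-- Freeness gives a map from `P` to any subcomplex containing the generators, and by uniqueness it
is a section of the inclusion. -/
theorem IsFreeOn.generatedBy (h : IsFreeOn P k e) : GeneratedBy P k e := by
  intro S hS n
  obtain ⟨f, hf, -⟩ := h S.toCh (fun i => ⟨e i, hS i⟩)
  have h1 : f ≫ S.incl = 𝟙 P :=
    (h P e).unique (fun i => congrArg Subtype.val (hf i)) (fun _ => rfl)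
  refine eq_top_iff.2 fun x _ => ?_
  have : (S.incl.f n).hom ((f.f n).hom x) = x := congrArg (fun φ => (φ.f n).hom x) h1
  rw [← this]
  exact ((f.f n).hom x).2

theorem IsFreeOn.projective (h : IsFreeOn P k e) : Projective P where
  factors {E Y} f g hg := by
    choose y hy using fun i => epi_f_surjective g (k i) ((f.f (k i)).hom (e i))
    obtain ⟨l, hl, -⟩ := h E y
    refine ⟨l, h.generatedBy.hom_ext fun i => ?_⟩
    rw [← hy, ← hl]
    rfl

theorem IsFreeOn.finitelyGenerated [Finite ι] (h : IsFreeOn P k e) : FinitelyGenerated P :=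
  .of_generatedBy h.generatedBy

end Free

/-- The free complex on a finite generating family surjects onto `P`, and the surjection splits. -/
theorem exists_retract_of_finitelyGenerated_projective {P : Ch R} [Projective P]
    (h : FinitelyGenerated P) :
    ∃ (ι : Type u) (_ : Finite ι) (k : ι → ℤ) (F : Ch R) (e : ∀ i, F.X (k i)),
      IsFreeOn F k e ∧ Nonempty (Retract P F) := by
  obtain ⟨ι, hι, k, x, hx⟩ := h.exists_generatedBy
  obtain ⟨F, e, hF⟩ := exists_isFreeOn R k
  obtain ⟨f, hf, -⟩ := hF P x
  have : Epi f := epi_of_surjective f fun n => by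
    have := hx (Subcomplex.range f) (fun i => ⟨e i, hf i⟩) n
    exact LinearMap.range_eq_top.1 this
  exact ⟨ι, hι, k, F, e, hF, ⟨⟨Projective.factorThru (𝟙 P) f, f, Projective.factorThru_comp _ _⟩⟩⟩

end FiniteGeneration

/-! ### Corepresentability of `P ⊗̄ -` for finitely generated projective `P` -/

section Corepresentable

variable {R : Type u} [Ring R]

/-- Maps out of a free complex, as an additive group. -/
def IsFreeOn.homEquiv {Q : Ch R} {ι : Type u} {k : ι → ℤ} {e : ∀ i, Q.X (k i)}
    (h : IsFreeOn Q k e) (Y : Ch R) : (Q ⟶ Y) ≃+ ∀ i, Y.X (k i) :=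
  AddEquiv.ofBijective (AddMonoidHom.mk' (fun f i => (f.f (k i)).hom (e i)) fun _ _ => rfl)
    ⟨fun _ _ hfg => h.generatedBy.hom_ext fun i => congrFun hfg i, fun y => by
      obtain ⟨f, hf, -⟩ := h Y y
      exact ⟨f, funext hf⟩⟩

/-- The map `Hom(Q, Y) → (P ⊗̄ Y)_n` given by families of elements of `P` and `Q` in complementary
degrees. -/
def tensorPairing {P : Ch Rᵐᵒᵖ} {Q : Ch R} {ι : Type u} [Fintype ι] {k : ι → ℤ} (n : ℤ)
    (e : ∀ i, P.X (k i)) (e' : ∀ i, Q.X (n - k i)) :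
    preadditiveCoyoneda.obj (op Q) ⟶ (degTensor R n).obj P where
  app Y := AddCommGrpCat.ofHom <| AddMonoidHom.mk'
    (fun g : Q ⟶ Y => ∑ i, (modTmul (k i) (n - k i) (add_sub_cancel _ _) (e i)
      ((g.f (n - k i)).hom (e' i)) : ((degTensor R n).obj P).obj Y))
    (fun _ _ => (Finset.sum_congr rfl fun _ _ => modTmul_add _ _ _ _ _ _).trans
      Finset.sum_add_distrib)
  naturality Y Y' f := by
    ext g
    refine Eq.symm ((map_sum (((degTensor R n).obj P).map f).hom _ _).trans ?_)
    exact Finset.sum_congr rfl fun i _ => modTmul_map_right P f _ _ _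

theorem tensorPairing_app_apply {P : Ch Rᵐᵒᵖ} {Q : Ch R} {ι : Type u} [Fintype ι] {k : ι → ℤ}
    (n : ℤ) (e : ∀ i, P.X (k i)) (e' : ∀ i, Q.X (n - k i)) (Y : Ch R) (g : Q ⟶ Y) :
    ((tensorPairing n e e').app Y).hom g = ∑ i, modTmul (k i) (n - k i) (add_sub_cancel _ _) (e i)
      ((g.f (n - k i)).hom (e' i)) := rfl

/-- It suffices to compare maps into each group `A`. By adjunction and freeness of `P`, maps `(P ⊗̄
Y)_n ⟶ A` are families of additive maps `Y_{n - k i} → A`. Since `Hom(Q, Y)` is the product of the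
`Y_{n - k i}` over a finite index set, maps from it to `A` are the same families. -/
theorem isIso_tensorPairing {P : Ch Rᵐᵒᵖ} {Q : Ch R} {ι : Type u} [Fintype ι] {k : ι → ℤ} {n : ℤ}
    {e : ∀ i, P.X (k i)} {e' : ∀ i, Q.X (n - k i)} (hP : IsFreeOn P k e)
    (hQ : IsFreeOn Q (fun i => n - k i) e') : IsIso (tensorPairing n e e') := by
  classical
  refine @NatIso.isIso_of_isIso_app _ _ _ _ _ _ _ fun Y => ?_
  apply isIso_of_coyoneda_map_bijective
  intro A
  let E := hQ.homEquiv Y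
  constructor
  · intro φ φ' h
    apply toDualRight_injective
    refine hP.generatedBy.hom_ext fun i => dualRight_ext fun y => ?_
    rw [toDualRight_apply, toDualRight_apply]
    have hy : ((tensorPairing n e e').app Y).hom (E.symm (Pi.single i y)) =
        modTmul (k i) (n - k i) (add_sub_cancel _ _) (e i) y := by
      have hE : ∀ j, ((E.symm (Pi.single i y)).f (n - k j)).hom (e' j) =
          Pi.single (M := fun j => Y.X (n - k j)) i y j :=
        fun j => congrFun (E.apply_symm_apply (Pi.single i y)) j
      rw [tensorPairing_app_apply, Finset.sum_eq_single i]
      · rw [hE, Pi.single_eq_same]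
      · intro j _ hj
        rw [hE, Pi.single_eq_of_ne hj]
        exact map_zero (AddMonoidHom.mk' (fun y => modTmul (Y := Y) (n := n) (k j) (n - k j)
          (add_sub_cancel _ _) (e j) y) (modTmul_add _ _ _ _))
      · simp
    rw [← hy]
    exact congrArg (fun χ => χ.hom (E.symm (Pi.single i y))) h
  · intro χ
    -- The restriction of `χ` to the `i`-th factor of `Hom(Q, Y)`.
    let s : ∀ i, Y.X (n - k i) →+ A := fun i =>
      (χ.hom.comp E.symm.toAddMonoidHom).comp
        (AddMonoidHom.single (fun i => Y.X (n - k i)) i)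
    obtain ⟨ψ, hψ, -⟩ := hP (dualComplexRight Y n A) (fun i => dualRight.toHom.symm (s i))
    obtain ⟨φ, rfl⟩ := toDualRight_surjective ψ
    refine ⟨φ, ?_⟩
    ext g
    refine (congrArg φ.hom (tensorPairing_app_apply n e e' Y g)).trans ?_
    rw [map_sum]
    have h1 : ∀ i, φ.hom (modTmul (k i) (n - k i) (add_sub_cancel _ _) (e i)
        ((g.f (n - k i)).hom (e' i))) = s i (E g i) := fun i =>
      congrArg (fun z => dualRight.toHom z (E g i)) (hψ i)
    rw [Finset.sum_congr rfl fun i _ => h1 i]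
    change ∑ i, (χ.hom.comp E.symm.toAddMonoidHom) (Pi.single i (E g i)) = _
    rw [← map_sum, Finset.univ_sum_single]
    exact congrArg χ.hom (E.symm_apply_apply g)

/-- If `P` is a finitely generated projective complex of right modules, then each degree of
`P ⊗̄ -` is corepresented by a finitely generated projective complex of left modules. -/
theorem exists_degTensor_iso {P : Ch Rᵐᵒᵖ} [Projective P] (h : FinitelyGenerated P) (n : ℤ) :
    ∃ Q : Ch R, Projective Q ∧ FinitelyGenerated Q ∧
      Nonempty ((degTensor R n).obj P ≅ preadditiveCoyoneda.obj (op Q)) := by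
  obtain ⟨ι, hι, k, F, e, hF, ⟨ρ⟩⟩ := exists_retract_of_finitelyGenerated_projective h
  have := Fintype.ofFinite ι
  obtain ⟨Q, e', hQ⟩ := exists_isFreeOn R (fun i => n - k i)
  have := isIso_tensorPairing hF hQ
  let α : (degTensor R n).obj F ≅ preadditiveCoyoneda.obj (op Q) :=
    (asIso (tensorPairing n e e')).symm
  let Φ := degTensor R n
  let yo := preadditiveCoyoneda (C := Ch R)
  -- The idempotent of `F` with image `P` is carried to an idempotent of `Q` by full faithfulness of
  -- Yoneda; its image corepresents the functor of `P`.
  let ε : op Q ⟶ op Q := yo.preimage (α.inv ≫ Φ.map (ρ.r ≫ ρ.i) ≫ α.hom)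
  have hε : yo.map ε = α.inv ≫ Φ.map (ρ.r ≫ ρ.i) ≫ α.hom := yo.map_preimage _
  have hri : (ρ.r ≫ ρ.i) ≫ (ρ.r ≫ ρ.i) = ρ.r ≫ ρ.i := by simp
  have hεε : ε ≫ ε = ε := by
    apply yo.map_injective
    rw [yo.map_comp, hε]
    simp only [Category.assoc, Iso.hom_inv_id_assoc]
    rw [← Φ.map_comp_assoc, hri]
  obtain ⟨Q', i', r', h1, h2⟩ :=
    IsIdempotentComplete.idempotents_split Q ε.unop (congrArg Quiver.Hom.unop hεε)
  have h2' : i'.op ≫ r'.op = ε := congrArg Quiver.Hom.op h2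
  have h1' : r'.op ≫ i'.op = 𝟙 _ := congrArg Quiver.Hom.op h1
  have : Projective Q := hQ.projective
  have : Epi r' := epi_of_epi_fac h1
  refine ⟨Q', Retract.projective ⟨i', r', h1⟩, hQ.finitelyGenerated.of_epi r', ⟨⟨
    Φ.map ρ.i ≫ α.hom ≫ yo.map i'.op, yo.map r'.op ≫ α.inv ≫ Φ.map ρ.r, ?_, ?_⟩⟩⟩
  · simp only [Category.assoc]
    rw [← yo.map_comp_assoc, h2', hε]
    simp only [Category.assoc, Iso.hom_inv_id_assoc, ← Φ.map_comp]
    simp [Φ]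
  · have : yo.map r'.op ≫ yo.map ε ≫ yo.map i'.op = 𝟙 _ := by
      rw [← h2', yo.map_comp]
      simp only [Category.assoc, ← yo.map_comp]
      rw [h1', Category.comp_id, h1', yo.map_id]
    rw [← this, hε]
    simp

end Corepresentable

/-! ### Level complexes through exactness and dual extension properties -/

section Characterization

variable {R : Type u} [Ring R]

/-- In degree `n`, the complex `C ⊗̄ L` is exact at `C_{i+1} ⊗̄ L`. -/
def TensorExactAt (C : ChainComplex (Ch Rᵐᵒᵖ) ℕ) (L : Ch R) (n : ℤ) (i : ℕ) : Prop :=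
  ∀ z : ((degTensor R n).obj (C.X (i + 1))).obj L,
    (((degTensor R n).map (C.d (i + 1) i)).app L).hom z = 0 →
      ∃ w, (((degTensor R n).map (C.d (i + 2) (i + 1))).app L).hom w = z

theorem isZero_modTor_succ_iff {X : Ch Rᵐᵒᵖ} (P : ProjectiveResolution X) (L : Ch R) (i : ℕ) :
    IsZero (modTor (i + 1) X L) ↔ ∀ n, TensorExactAt P.complex L n i := by
  let F := (modTensor R).flip.obj L
  let K := (F.mapHomologicalComplex (ComplexShape.down ℕ)).obj P.complex
  have h1 : IsZero (modTor (i + 1) X L) ↔ K.ExactAt (i + 1) :=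
    (P.isoLeftDerivedObj F (i + 1)).isZero_iff.trans
      (HomologicalComplex.exactAt_iff_isZero_homology K (i + 1)).symm
  rw [h1, HomologicalComplex.exactAt_iff' K (i + 2) (i + 1) i (by simp) (by simp),
    HomologicalComplex.exact_iff_degreewise_exact]
  exact forall_congr' fun n => ShortComplex.ab_exact_iff _

theorem degTensor_map_comp_zero {X X' X'' : Ch Rᵐᵒᵖ} (f : X ⟶ X') (g : X' ⟶ X'') (w : f ≫ g = 0)
    (L : Ch R) (n : ℤ) :
    ((degTensor R n).map f).app L ≫ ((degTensor R n).map g).app L = 0 := by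
  let F := (modTensor R).flip.obj L
  have h : F.map f ≫ F.map g = 0 := by rw [← F.map_comp, w, F.map_zero]
  exact congrArg (fun φ => φ.f n) h

/-- The resolution of a syzygy obtained by deleting the degree `0` term. -/
theorem exists_truncated_resolution {C : Type*} [Category* C] [Abelian C] {X : C}
    (P : ProjectiveResolution X) :
    ∃ (X' : C) (P' : ProjectiveResolution X'),
      P'.complex = ChainComplex.truncate.obj P.complex := by
  let T := ChainComplex.truncate.obj P.complex
  have hT : ∀ n, T.ExactAt (n + 1) := fun n => by
    rw [HomologicalComplex.exactAt_iff' _ (n + 2) (n + 1) n (by simp) (by simp)]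
    exact P.exact_succ (n + 1)
  -- This cokernel of `P_2 ⟶ P_1` is the first syzygy.
  let Z := cokernel (T.d 1 0)
  let π : T ⟶ (ChainComplex.single₀ C).obj Z :=
    (ChainComplex.toSingle₀Equiv T Z).symm ⟨cokernel.π (T.d 1 0), cokernel.condition _⟩
  have hπ : π.f 0 = cokernel.π (T.d 1 0) := ChainComplex.toSingle₀Equiv_symm_apply_f_zero _ _
  have hq : QuasiIso π := ⟨fun n => by
    cases n with
    | zero =>
      rw [ChainComplex.quasiIsoAt₀_iff, ShortComplex.quasiIso_iff_of_zeros']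
      · refine (ShortComplex.exact_and_epi_g_iff_of_iso ?_).2
          ⟨ShortComplex.exact_cokernel (T.d 1 0), inferInstanceAs (Epi (cokernel.π (T.d 1 0)))⟩
        exact ShortComplex.isoMk (Iso.refl _) (Iso.refl _) (Iso.refl _)
          ((Category.id_comp _).trans (Category.comp_id _).symm)
          (((Category.id_comp _).trans hπ.symm).trans (Category.comp_id _).symm)
      · exact T.shape 0 0 (by simp)
      all_goals rfl
    | succ n =>
      rw [quasiIsoAt_iff_exactAt']
      · exact hT n
      · apply ChainComplex.exactAt_succ_single_obj⟩
  exact ⟨Z, { complex := T, projective := fun n => P.projective (n + 1), π := π, quasiIso := hq },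
    rfl⟩

/-- Dimension shifting: exactness at a later spot of a resolution is exactness at an earlier spot of
the truncated resolution, which still has finitely generated terms. -/
theorem level_iff (L : Ch R) :
    level R L ↔ ∀ (X : Ch Rᵐᵒᵖ) (P : ProjectiveResolution X),
      (∀ i, FinitelyGenerated (P.complex.X i)) → ∀ n i, TensorExactAt P.complex L n i := by
  constructor
  · intro h X P hP n i
    induction i generalizing X P with
    | zero => exact (isZero_modTor_succ_iff P L 0).1 (h X ⟨P, hP⟩) n
    | succ i ih =>
      obtain ⟨X', P', hP'⟩ := exists_truncated_resolution P
      have := ih X' P' (by rw [hP']; exact fun j => hP (j + 1))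
      rw [hP'] at this
      exact this
  · rintro h X ⟨P, hP⟩
    exact (isZero_modTor_succ_iff P L 0).2 fun n => h X P hP n 0

/-- Every map `Q_{i+1} ⟶ Y` vanishing on `Q_i` extends along `Q_{i+1} ⟶ Q_{i+2}`. -/
def ExtendsAt {Q : ℕ → Ch R} (q : ∀ i, Q i ⟶ Q (i + 1)) (Y : Ch R) (i : ℕ) : Prop :=
  ∀ f : Q (i + 1) ⟶ Y, q i ≫ f = 0 → ∃ g : Q (i + 2) ⟶ Y, q (i + 1) ≫ g = f

/-- A complex of finitely generated projective complexes of right modules has, in each degree, a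
dual sequence of finitely generated projective complexes of left modules. -/
theorem exists_dual_sequence (C : ChainComplex (Ch Rᵐᵒᵖ) ℕ) (hC : ∀ i, Projective (C.X i))
    (hC' : ∀ i, FinitelyGenerated (C.X i)) (n : ℤ) :
    ∃ (Q : ℕ → Ch R) (q : ∀ i, Q i ⟶ Q (i + 1)),
      (∀ i, Projective (Q i)) ∧ (∀ i, FinitelyGenerated (Q i)) ∧ (∀ i, q i ≫ q (i + 1) = 0) ∧
      ∀ Y i, TensorExactAt C Y n i ↔ ExtendsAt q Y i := by
  choose Q hQ hQ' α using fun i => have := hC i; exists_degTensor_iso (hC' i) n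
  replace α := fun i => (α i).some
  let Φ := degTensor R n
  let yo := preadditiveCoyoneda (C := Ch R)
  -- Corepresentation is contravariant, so the differentials of `C` turn into maps raising the
  -- index.
  let q : ∀ i, Q i ⟶ Q (i + 1) := fun i =>
    (yo.preimage ((α (i + 1)).inv ≫ Φ.map (C.d (i + 1) i) ≫ (α i).hom)).unop
  let β : ∀ i Y, (Q i ⟶ Y) ≃+ (Φ.obj (C.X i)).obj Y := fun i Y =>
    ((α i).app Y).symm.addCommGroupIsoToAddEquiv
  have hβ : ∀ i Y (g : Q (i + 1) ⟶ Y),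
      β i Y (q i ≫ g) = ((Φ.map (C.d (i + 1) i)).app Y).hom (β (i + 1) Y g) := by
    intro i Y g
    have h1 : yo.map (q i).op = (α (i + 1)).inv ≫ Φ.map (C.d (i + 1) i) ≫ (α i).hom :=
      yo.map_preimage _
    have h2 : yo.map (q i).op ≫ (α i).inv = (α (i + 1)).inv ≫ Φ.map (C.d (i + 1) i) := by
      rw [h1]; simp
    exact congrArg (fun φ => (φ.app Y).hom g) h2
  refine ⟨Q, q, hQ, hQ', fun i => ?_, fun Y i => ?_⟩
  -- Tracing the identity of `Q (i + 2)` through the isomorphisms reduces this to `d ∘ d = 0` in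
  -- `C`.
  · apply (β i _).injective
    have h := hβ (i + 1) _ (𝟙 (Q (i + 2)))
    rw [Category.comp_id] at h
    rw [hβ, h, map_zero]
    exact congrArg (fun φ => φ.hom (β (i + 2) (Q (i + 2)) (𝟙 _)))
      (degTensor_map_comp_zero (C.d (i + 2) (i + 1)) (C.d (i + 1) i) (C.d_comp_d _ _ _) _ n)
  · constructor
    · intro h f hf
      obtain ⟨w, hw⟩ := h (β (i + 1) Y f) ((hβ i Y f).symm.trans (by rw [hf, map_zero]))
      obtain ⟨g, rfl⟩ := (β (i + 2) Y).surjective w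
      exact ⟨g, (β (i + 1) Y).injective ((hβ (i + 1) Y g).trans hw)⟩
    · intro h z hz
      obtain ⟨f, rfl⟩ := (β (i + 1) Y).surjective z
      obtain ⟨g, rfl⟩ := h f ((β i Y).injective ((hβ i Y f).trans (hz.trans (map_zero _).symm)))
      exact ⟨β (i + 2) Y g, (hβ (i + 1) Y g).symm⟩

/-- The dual modules consist of merely additive maps, so injectivity of `A` as an abelian group is
enough after forgetting the `S`-action. -/
theorem exists_extension_of_injective {A : AddCommGrpCat.{u}} [Injective A] {S : Type u} [Ring S]
    {M₁ M₂ M₃ : ModuleCat.{u} S} {f : M₁ ⟶ M₂} {g : M₂ ⟶ M₃} {w : f ≫ g = 0}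
    (h : (ShortComplex.mk f g w).Exact) (φ : M₂ →+ A) (hφ : ∀ x, φ (f.hom x) = 0) :
    ∃ ψ : M₃ →+ A, ∀ x, ψ (g.hom x) = φ x := by
  let F := forget₂ (ModuleCat.{u} S) AddCommGrpCat.{u}
  have hF : (ShortComplex.mk (F.map f) (F.map g) (by rw [← F.map_comp, w, F.map_zero])).Exact :=
    h.map F
  let φ' : F.obj M₂ ⟶ A := AddCommGrpCat.ofHom φ
  have hφ' : F.map f ≫ φ' = 0 := by
    ext x
    exact hφ x
  exact ⟨(hF.descToInjective φ' hφ').hom,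
    fun x => congrArg (fun χ => χ.hom x) (hF.comp_descToInjective φ' hφ')⟩

/-- Projective complexes are flat for the modified tensor product. -/
theorem tensorExactAt_of_projective (C : ChainComplex (Ch Rᵐᵒᵖ) ℕ) (i : ℕ)
    (hC : (ShortComplex.mk _ _ (C.d_comp_d (i + 2) (i + 1) i)).Exact) (L : Ch R) [Projective L]
    (n : ℤ) : TensorExactAt C L n i := by
  let f := ((degTensor R n).map (C.d (i + 2) (i + 1))).app L
  let g := ((degTensor R n).map (C.d (i + 1) i)).app L
  intro z hz
  -- Since the cokernel of `f` embeds in `A`, an element lies in the image of `f` as soon as `φ`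
  -- kills it.
  let A := Injective.under (cokernel f)
  let φ : ((degTensor R n).obj (C.X (i + 1))).obj L ⟶ A := cokernel.π f ≫ Injective.ι (cokernel f)
  have hφ : f ≫ φ = 0 := by simp [φ]
  have hexact : (ShortComplex.mk (dualComplexLeftMap (C.d (i + 1) i) n A)
      (dualComplexLeftMap (C.d (i + 2) (i + 1)) n A) (by
        ext q x
        refine dualLeft_ext fun y => ?_
        refine (congrArg (dualLeft.toHom x) ?_).trans (map_zero (dualLeft.toHom x))
        exact congrArg (fun ψ => (ψ.f (n - q)).hom y) (C.d_comp_d (i + 2) (i + 1) i))).Exact := by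
    apply HomologicalComplex.exact_of_degreewise_exact
    intro q
    rw [ShortComplex.moduleCat_exact_iff]
    intro x hx
    have hC' := hC.map (HomologicalComplex.eval _ _ (n - q))
    obtain ⟨ψ, hψ⟩ := exists_extension_of_injective hC' (dualLeft.toHom x)
      (fun y => congrArg (fun t => dualLeft.toHom t y) hx)
    exact ⟨dualLeft.toHom.symm ψ, dualLeft_ext hψ⟩
  have h0 : toDualLeft φ ≫ dualComplexLeftMap (C.d (i + 2) (i + 1)) n A = 0 := by
    rw [← toDualLeft_naturality]
    change toDualLeft (f ≫ φ) = 0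
    rw [hφ]
    rfl
  -- Projectivity of `L` lifts the transpose of `φ` along the exact dual sequence. Transposing back,
  -- `φ` factors through `g`, hence kills `z`.
  obtain ⟨ψ, hψ⟩ := toDualLeft_surjective (hexact.liftFromProjective (toDualLeft φ) h0)
  have h1 : g ≫ ψ = φ := by
    apply toDualLeft_injective
    rw [toDualLeft_naturality, hψ]
    exact hexact.liftFromProjective_comp _ _
  have h2 : φ.hom z = 0 := by
    rw [← h1]
    exact (congrArg ψ.hom hz).trans (map_zero _)
  have h3 : (cokernel.π f).hom z = 0 :=
    (AddCommGrpCat.mono_iff_injective (Injective.ι (cokernel f))).1 inferInstance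
      (h2.trans (map_zero _).symm)
  exact (ShortComplex.ab_exact_iff _).1 (ShortComplex.exact_cokernel f) z h3

end Characterization

/-! ### Closure properties, starting with projectives, retracts and products -/

section Closure

variable {R : Type u} [Ring R]

/-- Sequences of finitely generated projective complexes which test whether a complex is level. -/
structure IsTestSequence {Q : ℕ → Ch R} (q : ∀ i, Q i ⟶ Q (i + 1)) : Prop where
  projective : ∀ i, Projective (Q i)
  finitelyGenerated : ∀ i, FinitelyGenerated (Q i)
  comp_eq_zero : ∀ i, q i ≫ q (i + 1) = 0
  extendsAt : ∀ Y, level R Y → ∀ i, ExtendsAt q Y i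

/-- Levelness of other complexes can be used on the same sequence that tests `L`, because a test
sequence has the extension property for all level complexes at once. -/
theorem level_of_extendsAt {L : Ch R}
    (h : ∀ (Q : ℕ → Ch R) (q : ∀ i, Q i ⟶ Q (i + 1)), IsTestSequence q → ∀ i, ExtendsAt q L i) :
    level R L := by
  refine (level_iff L).2 fun X P hP n i => ?_
  obtain ⟨Q, q, h₁, h₂, h₃, h₄⟩ := exists_dual_sequence P.complex P.projective hP n
  exact (h₄ L i).2 (h Q q ⟨h₁, h₂, h₃, fun Y hY i => (h₄ Y i).1 ((level_iff Y).1 hY X P hP n i)⟩ i)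

theorem level_of_projective (L : Ch R) [Projective L] : level R L :=
  (level_iff L).2 fun _ P _ n i => tensorExactAt_of_projective P.complex i (P.exact_succ i) L n

theorem level_of_retract {X Y : Ch R} (ρ : Retract X Y) (hY : level R Y) : level R X := by
  refine level_of_extendsAt fun Q q hq i f hf => ?_
  obtain ⟨g, hg⟩ := hq.extendsAt Y hY i (f ≫ ρ.i) (by rw [← Category.assoc, hf, zero_comp])
  exact ⟨g ≫ ρ.r, by rw [← Category.assoc, hg, Category.assoc, ρ.retract, Category.comp_id]⟩

theorem level_of_iso {X Y : Ch R} (e : X ≅ Y) (hY : level R Y) : level R X :=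
  level_of_retract ⟨e.hom, e.inv, e.hom_inv_id⟩ hY

theorem level_of_isLimit_fan {ι : Type u} {F : ι → Ch R} {c : Fan F} (hc : IsLimit c)
    (h : ∀ i, level R (F i)) : level R c.pt := by
  refine level_of_extendsAt fun Q q hq i f hf => ?_
  choose g hg using fun j => hq.extendsAt (F j) (h j) i (f ≫ c.proj j)
    (by rw [← Category.assoc, hf, zero_comp])
  refine ⟨hc.lift (Fan.mk _ g), Fan.IsLimit.hom_ext hc _ _ fun j => ?_⟩
  rw [Category.assoc, ← hg]
  exact congrArg (q (i + 1) ≫ ·) (hc.fac (Fan.mk _ g) ⟨j⟩)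

/-! ### Extensions, kernels of epimorphisms and pure exact sequences -/

section ShortExact

variable {S : ShortComplex (Ch R)}

/-- Extend the composite to `S.X₃`, lift this extension to `S.X₂` by projectivity, and extend the
remaining error, which lies in `S.X₁`. -/
theorem level_of_extension (hS : S.ShortExact) (h₁ : level R S.X₁) (h₃ : level R S.X₃) :
    level R S.X₂ := by
  have := hS.mono_f
  have := hS.epi_g
  refine level_of_extendsAt fun Q q hq i f hf => ?_
  have := hq.projective (i + 2)
  obtain ⟨a, ha⟩ := hq.extendsAt _ h₃ i (f ≫ S.g) (by rw [← Category.assoc, hf, zero_comp])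
  let b := Projective.factorThru a S.g
  have hb : b ≫ S.g = a := Projective.factorThru_comp _ _
  let e := hS.exact.lift (f - q (i + 1) ≫ b) (by simp [hb, ha])
  have he : e ≫ S.f = f - q (i + 1) ≫ b := hS.exact.lift_f _ _
  obtain ⟨g, hg⟩ := hq.extendsAt _ h₁ i e (by
    rw [← cancel_mono S.f, Category.assoc, he, Preadditive.comp_sub, hf, ← Category.assoc,
      hq.comp_eq_zero, zero_comp, zero_comp, sub_zero])
  refine ⟨g ≫ S.f + b, ?_⟩
  rw [Preadditive.comp_add, ← Category.assoc, hg, he, sub_add_cancel]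

/-- An extension `a` of `f` into `S.X₂` need not land in `S.X₁`. Its image in `S.X₃` kills `q (i +
1)`, so it comes from `Q (i + 3)`; subtracting a lift of that corrects `a` without changing its
restriction to `Q (i + 1)`. -/
theorem level_of_kernel (hS : S.ShortExact) (h₂ : level R S.X₂) (h₃ : level R S.X₃) :
    level R S.X₁ := by
  have := hS.mono_f
  have := hS.epi_g
  refine level_of_extendsAt fun Q q hq i f hf => ?_
  have := hq.projective (i + 3)
  obtain ⟨a, ha⟩ := hq.extendsAt _ h₂ i (f ≫ S.f) (by rw [← Category.assoc, hf, zero_comp])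
  -- The extension property is needed one index further than for `f`, which is why all indices are
  -- carried along.
  obtain ⟨b, hb⟩ := hq.extendsAt _ h₃ (i + 1) (a ≫ S.g) (by
    rw [← Category.assoc, ha, Category.assoc, S.zero, comp_zero])
  let b' := Projective.factorThru b S.g
  have hb' : b' ≫ S.g = b := Projective.factorThru_comp _ _
  let e := hS.exact.lift (a - q (i + 2) ≫ b') (by
    rw [Preadditive.sub_comp, Category.assoc, hb']
    exact sub_eq_zero.2 hb.symm)
  have he : e ≫ S.f = a - q (i + 2) ≫ b' := hS.exact.lift_f _ _
  refine ⟨e, ?_⟩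
  rw [← cancel_mono S.f, Category.assoc, he, Preadditive.comp_sub, ha, ← Category.assoc,
    hq.comp_eq_zero (i + 1), zero_comp, sub_zero]

/-- Makes purity applicable: a map killed by `q i` factors through this cokernel, from which maps
lift along pure quotients. -/
theorem finitelyPresented_cokernel {Q : ℕ → Ch R} {q : ∀ i, Q i ⟶ Q (i + 1)}
    (hq : IsTestSequence q) (i : ℕ) : FinitelyPresented (cokernel (q i)) :=
  ⟨ShortComplex.mk (q i) (cokernel.π (q i)) (cokernel.condition _), ShortComplex.exact_cokernel _,
    inferInstanceAs (Epi (cokernel.π (q i))), ⟨Iso.refl _⟩,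
    ⟨hq.projective _, hq.finitelyGenerated _⟩, ⟨hq.projective _, hq.finitelyGenerated _⟩⟩

theorem PureExact.exists_lift (hS : PureExact S) {F : Ch R} (hF : FinitelyPresented F)
    (f : F ⟶ S.X₃) : ∃ g : F ⟶ S.X₂, g ≫ S.g = f :=
  (AddCommGrpCat.epi_iff_surjective _).1 (hS.map_shortExact F hF).epi_g f

theorem level_of_pureExact_quotient (hS : PureExact S) (h₂ : level R S.X₂) : level R S.X₃ := by
  refine level_of_extendsAt fun Q q hq i f hf => ?_
  obtain ⟨a, ha⟩ := hS.exists_lift (finitelyPresented_cokernel hq i) (cokernel.desc (q i) f hf)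
  obtain ⟨b, hb⟩ := hq.extendsAt _ h₂ i (cokernel.π (q i) ≫ a) (by simp)
  exact ⟨b ≫ S.g, by rw [← Category.assoc, hb, Category.assoc, ha, cokernel.π_desc]⟩

/-- As for kernels of epimorphisms, but the correction factors through the cokernel of `q (i + 1)`
and is lifted by purity, so levelness of `S.X₃` is not needed. -/
theorem level_of_pureExact_sub (hS : PureExact S) (h₂ : level R S.X₂) : level R S.X₁ := by
  have := hS.shortExact.mono_f
  refine level_of_extendsAt fun Q q hq i f hf => ?_
  obtain ⟨a, ha⟩ := hq.extendsAt _ h₂ i (f ≫ S.f) (by rw [← Category.assoc, hf, zero_comp])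
  obtain ⟨b, hb⟩ := hS.exists_lift (finitelyPresented_cokernel hq (i + 1))
    (cokernel.desc (q (i + 1)) (a ≫ S.g) (by
      rw [← Category.assoc, ha, Category.assoc, S.zero, comp_zero]))
  let e := hS.shortExact.exact.lift (a - cokernel.π (q (i + 1)) ≫ b) (by
    rw [Preadditive.sub_comp, Category.assoc, hb, cokernel.π_desc, sub_self])
  have he : e ≫ S.f = a - cokernel.π (q (i + 1)) ≫ b := hS.shortExact.exact.lift_f _ _
  refine ⟨e, ?_⟩
  rw [← cancel_mono S.f, Category.assoc, he, Preadditive.comp_sub, ha, ← Category.assoc,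
    cokernel.condition, zero_comp, sub_zero]

end ShortExact

/-! ### Filtered colimits -/

section Filtered

variable {J : Type u} [SmallCategory J] [IsFiltered J] {F : J ⥤ Ch R} {c : Cocone F}

theorem exists_rep_of_isColimit (hc : IsColimit c) {n : ℤ} (x : c.pt.X n) :
    ∃ j y, ((c.ι.app j).f n).hom y = x :=
  Concrete.isColimit_exists_rep _
    (isColimitOfPreserves (HomologicalComplex.eval (ModuleCat.{u} R) (ComplexShape.down ℤ) n) hc) x

theorem exists_map_eq_zero_of_isColimit (hc : IsColimit c) {n : ℤ} {j : J} (y : (F.obj j).X n)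
    (hy : ((c.ι.app j).f n).hom y = 0) : ∃ (k : J) (a : j ⟶ k), ((F.map a).f n).hom y = 0 := by
  obtain ⟨k, a, b, h⟩ := Concrete.isColimit_exists_of_rep_eq _
    (isColimitOfPreserves (HomologicalComplex.eval (ModuleCat.{u} R) (ComplexShape.down ℤ) n) hc)
    y (0 : (F.obj j).X n) (hy.trans (map_zero ((c.ι.app j).f n).hom).symm)
  exact ⟨k, a, h.trans (map_zero ((F.map b).f n).hom)⟩

/-- Maps from a finitely generated projective complex to a filtered colimit factor through a
stage. -/
theorem exists_factorization_of_isColimit (hc : IsColimit c) {Q : Ch R} [Projective Q]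
    (hQ : FinitelyGenerated Q) (f : Q ⟶ c.pt) : ∃ (j : J) (g : Q ⟶ F.obj j), g ≫ c.ι.app j = f := by
  classical
  obtain ⟨ι, hι, k, P, e, hP, ⟨ρ⟩⟩ := exists_retract_of_finitelyGenerated_projective hQ
  have := Fintype.ofFinite ι
  choose j y hy using fun i => exists_rep_of_isColimit hc (((ρ.r ≫ f).f (k i)).hom (e i))
  obtain ⟨m, hm⟩ := IsFiltered.sup_objs_exists (Finset.univ.image j)
  let a : ∀ i, j i ⟶ m := fun i => (hm (Finset.mem_image_of_mem j (Finset.mem_univ i))).some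
  obtain ⟨g, hg, -⟩ := hP (F.obj m) (fun i => ((F.map (a i)).f (k i)).hom (y i))
  have : g ≫ c.ι.app m = ρ.r ≫ f := by
    refine hP.generatedBy.hom_ext fun i => ?_
    rw [← hy, ← c.w (a i)]
    exact congrArg ((c.ι.app m).f (k i)).hom (hg i)
  exact ⟨m, ρ.i ≫ g, by rw [Category.assoc, this, ρ.retract_assoc]⟩

/-- A map from a finitely generated complex to a stage of a filtered colimit which vanishes in the
colimit vanishes at a later stage. -/
theorem exists_comp_map_eq_zero_of_isColimit (hc : IsColimit c) {Q : Ch R}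
    (hQ : FinitelyGenerated Q) {j : J} (g : Q ⟶ F.obj j) (hg : g ≫ c.ι.app j = 0) :
    ∃ (m : J) (a : j ⟶ m), g ≫ F.map a = 0 := by
  classical
  obtain ⟨ι, hι, k, x, hx⟩ := hQ.exists_generatedBy
  have := Fintype.ofFinite ι
  have key : ∀ s : Finset ι, ∃ (m : J) (a : j ⟶ m), ∀ i ∈ s,
      ((g ≫ F.map a).f (k i)).hom (x i) = 0 := by
    intro s
    induction s using Finset.induction_on with
    | empty => exact ⟨j, 𝟙 j, by simp⟩
    | insert i s _ ih =>
      obtain ⟨m, a, ha⟩ := ih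
      obtain ⟨m', b, hb⟩ := exists_map_eq_zero_of_isColimit hc
        (((g ≫ F.map a).f (k i)).hom (x i)) (by
          have : (g ≫ F.map a) ≫ c.ι.app m = 0 := by rw [Category.assoc, c.w, hg]
          exact congrArg (fun φ => (φ.f (k i)).hom (x i)) this)
      have hab : g ≫ F.map (a ≫ b) = (g ≫ F.map a) ≫ F.map b := by
        rw [F.map_comp, Category.assoc]
      refine ⟨m', a ≫ b, fun i' hi' => ?_⟩
      rw [hab]
      rcases Finset.mem_insert.1 hi' with rfl | hi'
      · exact hb
      · exact (congrArg ((F.map b).f (k i')).hom (ha i' hi')).trans (map_zero _)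
  obtain ⟨m, a, ha⟩ := key Finset.univ
  exact ⟨m, a, hx.hom_ext fun i => ha i (Finset.mem_univ i)⟩

/-- The map and its vanishing on `Q i` both descend to a common stage, where the extension exists.
-/
theorem level_of_isColimit (hc : IsColimit c) (h : ∀ j, level R (F.obj j)) : level R c.pt := by
  refine level_of_extendsAt fun Q q hq i f hf => ?_
  have := hq.projective (i + 1)
  obtain ⟨j, f', rfl⟩ := exists_factorization_of_isColimit hc (hq.finitelyGenerated (i + 1)) f
  obtain ⟨m, a, ha⟩ := exists_comp_map_eq_zero_of_isColimit hc (hq.finitelyGenerated i)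
    (q i ≫ f') (by rw [Category.assoc, hf])
  obtain ⟨g, hg⟩ := hq.extendsAt _ (h m) i (f' ≫ F.map a) (by rw [← Category.assoc, ha])
  exact ⟨g ≫ c.ι.app m, by rw [← Category.assoc, hg, Category.assoc, c.w]⟩

end Filtered

/-! ### Direct sums and transfinite extensions -/

theorem level_sigma_of_finite {ι : Type u} [Finite ι] (F : ι → Ch R) (h : ∀ i, level R (F i)) :
    level R (∐ F) := by
  have : HasFiniteBiproducts (Ch R) := HasFiniteBiproducts.of_hasFiniteProducts
  exact level_of_iso ((biproduct.isoCoproduct F).symm ≪≫ biproduct.isoProduct F)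
    (level_of_isLimit_fan (productIsProduct F) h)

/-- A coproduct is the filtered colimit of its finite subcoproducts, and these are products. -/
theorem level_of_isColimit_cofan {ι : Type u} {F : ι → Ch R} {c : Cofan F} (hc : IsColimit c)
    (h : ∀ i, level R (F i)) : level R c.pt := by
  classical
  refine level_of_iso (hc.coconePointUniqueUpToIso (coproductIsCoproduct F)) ?_
  have := level_of_isColimit (c := CoproductsFromFiniteFiltered.finiteSubcoproductsCocone F)
    (CoproductsFromFiniteFiltered.isColimitFiniteSubproductsCocone F)
    fun s => level_sigma_of_finite (fun x : s => (Discrete.functor F).obj x.1) fun x => h x.1.as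
  exact this

theorem level_of_isTransfiniteExtension {X : Ch R} (h : IsTransfiniteExtension (level R) X) :
    level R X := by
  obtain ⟨J, _, _, _, _, F, c, hF, hbot, hsucc, ⟨hc⟩, ⟨e⟩⟩ := h
  have hlevel : ∀ j, level R (F.obj j) := by
    intro j
    induction j using SuccOrder.limitRecOn with
    | isMin j hj => rwa [hj.eq_bot]
    | succ j hj ih =>
      obtain ⟨hmono, hcoker⟩ := hsucc j hj
      exact level_of_extension (S := ShortComplex.mk _ _ (cokernel.condition _))
        { exact := ShortComplex.exact_cokernel _
          mono_f := hmono
          epi_g := inferInstanceAs (Epi (cokernel.π _)) } ih hcoker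
    | isSuccLimit j hj ih =>
      -- Nonemptiness makes the initial segment below `j` filtered.
      have : Nonempty (Set.Iio j) := ⟨⟨⊥, hj.bot_lt⟩⟩
      have := level_of_isColimit (c := (Set.principalSegIio j).cocone F)
        (F.isColimitOfIsWellOrderContinuous j hj) fun k => ih k.1 k.2
      exact this
  exact level_of_iso e.symm (level_of_isColimit hc hlevel)

end Closure

end

end LevelComplexes

/-! ### The main theorem -/

theorem mainTheorem9 (R : Type u) [Ring R] :
    -- vanishing of the higher modified Tor
    (∀ L : LevelComplexes.Ch R, LevelComplexes.level R L →
      ∀ n : ℕ, 0 < n → ∀ X : LevelComplexes.Ch Rᵐᵒᵖ, LevelComplexes.IsFPInfinity X →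
        IsZero (LevelComplexes.modTor n X L)) ∧
    -- pure subcomplexes and pure quotients
    (∀ S : ShortComplex (LevelComplexes.Ch R), LevelComplexes.PureExact S →
      LevelComplexes.level R S.X₂ →
        LevelComplexes.level R S.X₁ ∧ LevelComplexes.level R S.X₃) ∧
    -- resolving: projectives, extensions, kernels of epimorphisms
    ((∀ P : LevelComplexes.Ch R, Projective P → LevelComplexes.level R P) ∧
      (∀ S : ShortComplex (LevelComplexes.Ch R), S.ShortExact →
        LevelComplexes.level R S.X₁ → LevelComplexes.level R S.X₃ →
          LevelComplexes.level R S.X₂) ∧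
      (∀ S : ShortComplex (LevelComplexes.Ch R), S.ShortExact →
        LevelComplexes.level R S.X₂ → LevelComplexes.level R S.X₃ →
          LevelComplexes.level R S.X₁)) ∧
    -- direct products
    (∀ (ι : Type u) (F : ι → LevelComplexes.Ch R) (c : Fan F), Nonempty (IsLimit c) →
      (∀ i, LevelComplexes.level R (F i)) → LevelComplexes.level R c.pt) ∧
    -- direct sums
    (∀ (ι : Type u) (F : ι → LevelComplexes.Ch R) (c : Cofan F), Nonempty (IsColimit c) →
      (∀ i, LevelComplexes.level R (F i)) → LevelComplexes.level R c.pt) ∧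
    -- retracts
    (∀ X Y : LevelComplexes.Ch R, Nonempty (Retract X Y) →
      LevelComplexes.level R Y → LevelComplexes.level R X) ∧
    -- direct limits
    (∀ (J : Type u) [SmallCategory J] [IsFiltered J] (F : J ⥤ LevelComplexes.Ch R)
      (c : Cocone F), Nonempty (IsColimit c) →
        (∀ j, LevelComplexes.level R (F.obj j)) → LevelComplexes.level R c.pt) ∧
    -- transfinite extensions
    (∀ X : LevelComplexes.Ch R,
      LevelComplexes.IsTransfiniteExtension (LevelComplexes.level R) X →
        LevelComplexes.level R X) := by
  refine ⟨fun L hL n hn X hX => ?_, fun S hS h => ⟨LevelComplexes.level_of_pureExact_sub hS h,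
      LevelComplexes.level_of_pureExact_quotient hS h⟩,
    ⟨fun P _ => LevelComplexes.level_of_projective P,
      fun S hS h₁ h₃ => LevelComplexes.level_of_extension hS h₁ h₃,
      fun S hS h₂ h₃ => LevelComplexes.level_of_kernel hS h₂ h₃⟩,
    fun ι F c ⟨hc⟩ h => LevelComplexes.level_of_isLimit_fan hc h,
    fun ι F c ⟨hc⟩ h => LevelComplexes.level_of_isColimit_cofan hc h,
    fun X Y ⟨ρ⟩ h => LevelComplexes.level_of_retract ρ h,
    fun J _ _ F c ⟨hc⟩ h => LevelComplexes.level_of_isColimit hc h,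
    fun X h => LevelComplexes.level_of_isTransfiniteExtension h⟩
  obtain ⟨i, rfl⟩ : ∃ i, n = i + 1 := ⟨n - 1, by omega⟩
  obtain ⟨P, hP⟩ := hX
  exact (LevelComplexes.isZero_modTor_succ_iff P L i).2 fun m =>
    (LevelComplexes.level_iff L).1 hL X P hP m i
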